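/- For $d\ge 2$ and $n\ge 0$ let $T_n(d)$ be the rooted $d$-ary tree with $n$ levels and $\mathrm{Aut}(T_n(d))$ the group of its automorphisms as a rooted tree. For $m\le n$ let $\mathrm{sgn}_m:\mathrm{Aut}(T_n(d))\to\{\pm1\}$ send a tree automorphism to the sign of the permutation that it induces on the $d^m$ vertices of level $m$. Identify $\mathrm{Aut}(T_n(d))$ with the wreath product $\mathrm{Aut}(T_{n-1}(d))\wr \mathrm{Aut}(T_1(d))$, where $\mathrm{Aut}(T_1(d))\cong S_d$ permutes the $d$ subtrees rooted at the vertices of level $1$. The group $E_n^2(3)\le\mathrm{Aut}(T_n(3))$ is defined recursively by $E_n^2(3)=\mathrm{Aut}(T_n(3))$ for $n<2$, and $E_n^2(3)=\bigl(E_{n-1}^2(3)\wr\mathrm{Aut}(T_1(3))\bigr)\cap\ker(\mathrm{sgn}_2)$ for $n\ge 2$. **Theorem.** Let $K$ be a number field, let $f(z)=2z^3-3z^2+1$, and denote by $f^n$ the $n$-th iterate of $f$ under composition. Let $\mathfrak p$ and $\mathfrak q$ be primes of $K$ lying above $2$ and $3$, respectively, with normalized valuations $v_{\mathfrak p}$ and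 $v_{\mathfrak q}$, and let $\alpha\in K$ be such that $$\bigl(v_{\mathfrak q}(\alpha)=1\ \text{ or }\ v_{\mathfrak q}(1-\alpha)=1\bigr)\quad\text{and}\quad\bigl(v_{\mathfrak p}(\alpha)=1\ \text{ or }\ v_{\mathfrak p}(1-\alpha)=1\bigr).$$ Then for every $n\ge 1$: 1. The polynomial $f^n(z)-\alpha$ is Eisenstein at $\mathfrak q$, possibly after a translation of the variable: for some $c\in\{0,1\}$ the polynomial $f^n(z+c)-\alpha$ has $\mathfrak q$-integral coefficients and is Eisenstein at $\mathfrak q$. Moreover $f^n(z)-\alpha$ is irreducible over $K$. 2. The Galois group over $K$ of the splitting field of $f^n(z)-\alpha$ is isomorphic to $E_n^2(3)$. -/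

import Mathlib

open Polynomial NumberField IsDedekindDomain

/-- The vertices of the rooted `d`-ary tree `T_n(d)` with `n` levels: words `(l_k, …, l_1)` of
length `k ≤ n` over an alphabet with `d` letters. The empty word is the root, the level of a
vertex is its length, and the vertex below `(l_{k-1}, …, l_1)` along the edge `l_k` is
`(l_k, l_{k-1}, …, l_1)`. -/
abbrev TreeVertex (d n : ℕ) : Type := {l : List (Fin d) // l.length ≤ n}

namespace TreeVertex

noncomputable instance instFintype (d n : ℕ) : Fintype (TreeVertex d n) :=
  haveI : Finite (TreeVertex d n) := (List.finite_length_le (Fin d) n).to_subtype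
  Fintype.ofFinite _

/-- The root. -/
def root (d n : ℕ) : TreeVertex d n := ⟨[], Nat.zero_le _⟩

/-- The parent of a vertex, `(l_k, l_{k-1}, …, l_1) ↦ (l_{k-1}, …, l_1)`. By convention the parent
of the root is the root itself. -/
def parent {d n : ℕ} (v : TreeVertex d n) : TreeVertex d n :=
  ⟨v.1.tail, by rw [List.length_tail]; exact (Nat.sub_le _ _).trans v.2⟩

/-- The copy of the vertex `w` of `T_n(d)` inside the subtree of `T_{n+1}(d)` rooted at the
vertex `i` of the first level. -/
def under {d n : ℕ} (w : TreeVertex d n) (i : Fin d) : TreeVertex d (n + 1) :=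
  ⟨w.1 ++ [i], by simpa using w.2⟩

theorem length_le_iff {d n : ℕ} (k : ℕ) (v : TreeVertex d n) :
    v.1.length ≤ k ↔ parent^[k] v = root d n := by
  induction k generalizing v with
  | zero => simp [root, Subtype.ext_iff]
  | succ k ih =>
    rw [Function.iterate_succ_apply, ← ih]
    simp [parent]

end TreeVertex

/-- `Aut(T_n(d))`: the automorphisms of the rooted tree `T_n(d)`, that is, the permutations of its
vertices that commute with taking parents (such a permutation fixes the root). -/
def treeAut (d n : ℕ) : Subgroup (Equiv.Perm (TreeVertex d n)) where
  carrier := {σ | ∀ v, σ v.parent = (σ v).parent}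
  one_mem' := fun _ => rfl
  mul_mem' := by
    intro σ τ hσ hτ v
    rw [Equiv.Perm.mul_apply, Equiv.Perm.mul_apply, hτ, hσ]
  inv_mem' := by
    intro σ hσ v
    rw [Equiv.Perm.inv_eq_iff_eq, hσ]
    simp

theorem treeAut_root {d n : ℕ} (σ : treeAut d n) :
    σ.1 (TreeVertex.root d n) = TreeVertex.root d n := by
  have h := σ.2 (TreeVertex.root d n)
  have h2 : (TreeVertex.root d n).parent = TreeVertex.root d n := rfl
  rw [h2] at h
  have h3 : (σ.1 (TreeVertex.root d n)).1.length
      = (σ.1 (TreeVertex.root d n)).1.length - 1 := by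
    conv_lhs => rw [h]
    simp [TreeVertex.parent]
  have h4 : ∀ x y : ℕ, x = y - 1 → x = y → x = 0 := by omega
  have h5 := h4 _ _ h3 rfl
  apply Subtype.ext
  exact List.length_eq_zero_iff.mp h5

/-- Tree automorphisms preserve the levels. -/
theorem treeAut_length {d n : ℕ} (σ : treeAut d n) (v : TreeVertex d n) :
    (σ.1 v).1.length = v.1.length := by
  have hit : ∀ k (w : TreeVertex d n),
      TreeVertex.parent^[k] (σ.1 w) = σ.1 (TreeVertex.parent^[k] w) := by
    intro k
    induction k with
    | zero => intro w; rfl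
    | succ k ih =>
      intro w
      rw [Function.iterate_succ_apply, Function.iterate_succ_apply, ← σ.2 w, ih]
  have key : ∀ k, (σ.1 v).1.length ≤ k ↔ v.1.length ≤ k := by
    intro k
    rw [TreeVertex.length_le_iff, TreeVertex.length_le_iff, hit]
    constructor
    · intro h
      exact σ.1.injective (h.trans (treeAut_root σ).symm)
    · intro h
      rw [h, treeAut_root]
  exact le_antisymm ((key _).2 le_rfl) ((key _).1 le_rfl)

/-- The action of `Aut(T_n(d))` on the set of vertices of level `m`. -/
def levelPerm (d n m : ℕ) :
    treeAut d n →* Equiv.Perm {v : TreeVertex d n // v.1.length = m} where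
  toFun σ := σ.1.subtypePerm (fun v => by rw [treeAut_length σ v])
  map_one' := by ext; rfl
  map_mul' := by intro σ τ; ext; rfl

/-- The restricted sign `sgn_m : Aut(T_n(d)) → {±1}` for `m ≤ n`: the sign of the permutation which
a tree automorphism induces on the `d ^ m` vertices of level `m`, that is, on the leaves of the
subtree `T_m(d)`. -/
noncomputable def restrictedSign (d n m : ℕ) : treeAut d n →* ℤˣ :=
  Equiv.Perm.sign.comp (levelPerm d n m)

/-- For a subgroup `H` of `Aut(T_n(d))`, the wreath product of `H` by `Aut(T_1(d)) = S_d`, embedded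
in `Aut(T_{n+1}(d))`: the element `((b_i)_i ; a)` permutes the `d` subtrees rooted at the vertices of
the first level by `a`, and maps the `i`-th one to the `a(i)`-th one by `b_i ∈ H`. -/
def treeWreath {d n : ℕ} (H : Subgroup (treeAut d n)) : Subgroup (treeAut d (n + 1)) where
  carrier := {σ | ∃ (b : Fin d → treeAut d n) (a : Equiv.Perm (Fin d)), (∀ i, b i ∈ H) ∧
    ∀ (i : Fin d) (w : TreeVertex d n), σ.1 (w.under i) = ((b i).1 w).under (a i)}
  one_mem' := ⟨fun _ => 1, 1, fun _ => H.one_mem, fun _ _ => rfl⟩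
  mul_mem' := by
    rintro σ τ ⟨b, a, hb, hσ⟩ ⟨b', a', hb', hτ⟩
    refine ⟨fun i => b (a' i) * b' i, a * a', fun i => H.mul_mem (hb _) (hb' _), fun i w => ?_⟩
    rw [Subgroup.coe_mul, Equiv.Perm.mul_apply, hτ, hσ]
    rfl
  inv_mem' := by
    rintro σ ⟨b, a, hb, hσ⟩
    refine ⟨fun i => (b (a⁻¹ i))⁻¹, a⁻¹, fun i => H.inv_mem (hb _), fun i w => ?_⟩
    rw [Subgroup.coe_inv, Equiv.Perm.inv_eq_iff_eq, hσ]
    simp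

/-- The group `E_n^m(d)`, for odd `d` and `m ≥ 1`: it is `Aut(T_n(d))` if `n < m`, and the
intersection of `E_{n-1}^m(d) ≀ Aut(T_1(d))` with the kernel of `sgn_m` if `n ≥ m`. -/
noncomputable def treeE (d m : ℕ) : (n : ℕ) → Subgroup (treeAut d n)
  | 0 => ⊤
  | n + 1 => if n + 1 < m then ⊤ else treeWreath (treeE d m n) ⊓ (restrictedSign d (n + 1) m).ker

/-- The polynomial `2 z ^ 3 - 3 z ^ 2 + 1`. -/
noncomputable def cubicPoly (K : Type*) [Field K] : K[X] := 2 * X ^ 3 - 3 * X ^ 2 + 1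

/-- The polynomial `f ^ n (z) - α`, where `f ^ n` is the `n`-th iterate of `f = 2 z ^ 3 - 3 z ^ 2 + 1`
under composition. -/
noncomputable def iterateSub {K : Type*} [Field K] (n : ℕ) (α : K) : K[X] :=
  (cubicPoly K).comp^[n] X - C α

/-- A polynomial over a number field `K` is Eisenstein at the prime `q` if its coefficients are
`q`-integral and it is Eisenstein at the maximal ideal of the valuation ring of `q`. -/
def IsEisensteinAtPrime {K : Type*} [Field K] [NumberField K] (q : HeightOneSpectrum (𝓞 K))
    (P : K[X]) : Prop :=
  ∃ g : ((q.valuation K).valuationSubring)[X],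
    g.map (algebraMap (q.valuation K).valuationSubring K) = P ∧
      g.IsEisensteinAt (IsLocalRing.maximalIdeal (q.valuation K).valuationSubring)

/-! Write t(x) = x(1 - x). The critical points of f are 0 and 1, and f interchanges them. Hence the
discriminant of f - x is a constant times t(x), and the product of t over the three preimages of x
is t(x)/4. If V(x) is the Vandermonde determinant of an ordering of the preimages of x, the product
of V over these preimages is therefore ±(27/8) V(x), and the orderings can be chosen down the tree
so that the sign is always plus. In such a labelling the absolute Galois group G of K acts on words,
and the sign of the permutation at a vertex is the product of the signs at its children
(`prod_sgn_galois`). This relation cuts out E_n (`treeAut.mem_treeE_iff`), so the image of G lies in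
E_n.

Modulo q, f is 1 - z^3, so f^n has the shape a + u z^(3^n). Since f permutes {0, 1}, some c in {0,
1} is sent by f^n to whichever of 0, 1 is near α, and f^n(z + c) - α is Eisenstein. Irreducibility
for all n makes G transitive on every level.

At p, a point x near 0 or 1 has a preimage x' near 0 or 1 with w(t(x'))^2 = w(t(x)). This yields a
path x_0 = α, x_1, ... along which the value of t is repeatedly halved. The value of t(α) is not a
square of a value from K, and adjoining a root of a cubic cannot turn a non-square value into a
fourth power, so w(t(x_m)) is not a square of a value from K(x_m). For j < m, 2V(x_j) has the value
of t(x_(j+1)), an element of K(x_m). Hence V(x_m) times any product of distinct earlier V(x_j) is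
outside K(x_m), and the signs along the path can be separated: some element fixing x_m has sign 1 at
each x_j with j < m and sign -1 at x_m.

The rest is group theory (`full_of_path`): by induction on m, the kernel of level m acts on level m
+ 1 as freely as the sign relation permits. The separating element is multiplied by commutators of
path-fixing elements, which have trivial signs on the path, until its signs on the current level are
all 1. Its cube then lies in the next kernel with unchanged path signs. The result is an element of
the level m kernel with an odd sign, which transitivity and commutators spread to every permitted
family. -/

/-! ### Groups acting on the infinite ternary tree -/

/-- An action on the words over `Fin 3` by automorphisms of the infinite rooted ternary tree. -/
class IsTreeAction (G : Type*) [Group G] [MulAction G (List (Fin 3))] : Prop where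
  smul_length : ∀ (g : G) (v : List (Fin 3)), (g • v).length = v.length
  smul_tail : ∀ (g : G) (v : List (Fin 3)), (g • v).tail = g • v.tail

namespace IsTreeAction

/-- The cyclic permutation of `Fin 3`. -/
def rot : Equiv.Perm (Fin 3) := finRotate 3

theorem rot_inv_apply (a : Fin 3) : rot⁻¹ a = a - 1 := by revert a; decide

theorem sign_rot : Equiv.Perm.sign rot = 1 := by decide

theorem pow_three_of_sign :
    ∀ σ : Equiv.Perm (Fin 3), Equiv.Perm.sign σ = 1 → σ ^ 3 = 1 := by decide

theorem exists_even_apply :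
    ∀ a b : Fin 3, ∃ σ : Equiv.Perm (Fin 3), Equiv.Perm.sign σ = 1 ∧ σ a = b := by decide

variable {G : Type*} [Group G] [MulAction G (List (Fin 3))] [IsTreeAction G]

variable (G) in
/-- The elements acting trivially on the words of length `k`. -/
def levelKer (k : ℕ) : Subgroup G where
  carrier := {g | ∀ v : List (Fin 3), v.length = k → g • v = v}
  one_mem' := fun _ _ => one_smul _ _
  mul_mem' := fun {g h} hg hh v hv => by rw [mul_smul, hh v hv, hg v hv]
  inv_mem' := fun {g} hg v hv => by rw [inv_smul_eq_iff, hg v hv]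

theorem smul_nil (g : G) : g • ([] : List (Fin 3)) = [] :=
  List.length_eq_zero_iff.mp (by rw [smul_length]; rfl)

theorem exists_loc (g : G) (v : List (Fin 3)) :
    ∃ π : Equiv.Perm (Fin 3), ∀ a, g • (a :: v) = π a :: g • v := by
  have h : ∀ a : Fin 3, ∃ b, g • (a :: v) = b :: g • v := by
    intro a
    have h1 := smul_tail g (a :: v)
    have h2 := smul_length g (a :: v)
    cases h3 : g • (a :: v) with
    | nil => rw [h3] at h2; simp at h2
    | cons b t => rw [h3] at h1; exact ⟨b, by rw [← List.tail_cons (a := a) (as := v), ← h1]; rfl⟩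
  choose p hp using h
  have hinj : Function.Injective p := by
    intro a b hab
    have : g • (a :: v) = g • (b :: v) := by rw [hp, hp, hab]
    simpa using smul_left_cancel g this
  exact ⟨Equiv.ofBijective p (Finite.injective_iff_bijective.mp hinj), hp⟩

/-- The permutation of the letters induced by `g` between the children of `v` and of `g • v`. -/
noncomputable def loc (g : G) (v : List (Fin 3)) : Equiv.Perm (Fin 3) := (exists_loc g v).choose

theorem smul_cons (g : G) (a : Fin 3) (v : List (Fin 3)) : g • (a :: v) = loc g v a :: g • v :=
  (exists_loc g v).choose_spec a

theorem loc_eq {g : G} {v : List (Fin 3)} {π : Equiv.Perm (Fin 3)}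
    (h : ∀ a, g • (a :: v) = π a :: g • v) : loc g v = π := by
  ext1 a
  have := h a
  rw [smul_cons] at this
  exact (List.cons.inj this).1

theorem loc_one (v : List (Fin 3)) : loc (1 : G) v = 1 := loc_eq fun a => by simp

theorem loc_mul (g h : G) (v : List (Fin 3)) : loc (g * h) v = loc g (h • v) * loc h v :=
  loc_eq fun a => by rw [mul_smul, smul_cons, smul_cons, mul_smul]; rfl

theorem loc_inv (g : G) (v : List (Fin 3)) : loc g⁻¹ v = (loc g (g⁻¹ • v))⁻¹ := by
  have h := loc_mul g g⁻¹ v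
  rw [mul_inv_cancel, loc_one] at h
  exact (inv_eq_of_mul_eq_one_right h.symm).symm

/-- The sign of `loc`. -/
noncomputable def sgn (g : G) (v : List (Fin 3)) : ℤˣ := Equiv.Perm.sign (loc g v)

theorem sgn_one (v : List (Fin 3)) : sgn (1 : G) v = 1 := by simp [sgn, loc_one]

theorem sgn_mul (g h : G) (v : List (Fin 3)) : sgn (g * h) v = sgn g (h • v) * sgn h v := by
  simp [sgn, loc_mul]

theorem sgn_inv (g : G) (v : List (Fin 3)) : sgn g⁻¹ v = sgn g (g⁻¹ • v) := by
  simp [sgn, loc_inv]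

theorem levelKer_succ_le (k : ℕ) : levelKer G (k + 1) ≤ levelKer G k := by
  intro g hg v hv
  have := hg (0 :: v) (by simp [hv])
  rw [smul_cons] at this
  exact (List.cons.inj this).2

theorem levelKer_antitone {j k : ℕ} (hjk : j ≤ k) : levelKer G k ≤ levelKer G j :=
  antitone_nat_of_succ_le levelKer_succ_le hjk

theorem mem_levelKer_zero (g : G) : g ∈ levelKer G 0 := fun v hv => by
  rw [List.length_eq_zero_iff.mp hv, smul_nil]

theorem mem_levelKer_succ_iff {k : ℕ} {g : G} : g ∈ levelKer G (k + 1) ↔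
    g ∈ levelKer G k ∧ ∀ v : List (Fin 3), v.length = k → loc g v = 1 := by
  constructor
  · intro hg
    have hk := levelKer_antitone (Nat.le_succ k) hg
    refine ⟨hk, fun v hv => loc_eq fun a => ?_⟩
    rw [hg _ (by simp [hv]), hk v hv]; rfl
  · rintro ⟨hk, hg⟩ v hv
    match v, hv with
    | a :: v, hv =>
      have hv' : v.length = k := by simpa using hv
      rw [smul_cons, hg v hv', hk v hv']; rfl

theorem loc_eq_one_of_mem {k : ℕ} {g : G} (hg : g ∈ levelKer G k) {v : List (Fin 3)}
    (hv : v.length < k) : loc g v = 1 :=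
  (mem_levelKer_succ_iff.mp (levelKer_antitone (Nat.succ_le_of_lt hv) hg)).2 v rfl

instance (k : ℕ) : (levelKer G k).Normal :=
  ⟨fun h hh g v hv => by
    rw [mul_smul, mul_smul, hh _ (by rw [smul_length, hv]), smul_inv_smul]⟩

theorem loc_conj {k : ℕ} (g : G) {h : G} (hh : h ∈ levelKer G k) {v : List (Fin 3)}
    (hv : v.length = k) :
    loc (g * h * g⁻¹) v = loc g (g⁻¹ • v) * loc h (g⁻¹ • v) * (loc g (g⁻¹ • v))⁻¹ := by
  rw [loc_mul, loc_mul, loc_inv, hh _ (by rw [smul_length, hv])]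

theorem sgn_conj {k : ℕ} (g : G) {h : G} (hh : h ∈ levelKer G k) {v : List (Fin 3)}
    (hv : v.length = k) : sgn (g * h * g⁻¹) v = sgn h (g⁻¹ • v) := by
  simp only [sgn, loc_conj g hh hv, map_mul, map_inv]
  rw [mul_comm, inv_mul_cancel_left]

theorem commutator_mem {k : ℕ} (g : G) {h : G} (hh : h ∈ levelKer G k) :
    g * h * g⁻¹ * h⁻¹ ∈ levelKer G k :=
  mul_mem (Subgroup.Normal.conj_mem inferInstance h hh g) (inv_mem hh)

theorem loc_mul_of_mem {k : ℕ} (g : G) {h : G} (hh : h ∈ levelKer G k) {v : List (Fin 3)}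
    (hv : v.length = k) : loc (g * h) v = loc g v * loc h v := by
  rw [loc_mul, hh v hv]

theorem loc_inv_of_mem {k : ℕ} {h : G} (hh : h ∈ levelKer G k) {v : List (Fin 3)}
    (hv : v.length = k) : loc h⁻¹ v = (loc h v)⁻¹ := by
  rw [loc_inv, inv_mem hh v hv]

theorem sgn_mul_of_mem {k : ℕ} (g : G) {h : G} (hh : h ∈ levelKer G k) {v : List (Fin 3)}
    (hv : v.length = k) : sgn (g * h) v = sgn g v * sgn h v := by
  rw [sgn_mul, hh v hv]

theorem sgn_commutator {k : ℕ} (g : G) {h : G} (hh : h ∈ levelKer G k) {v : List (Fin 3)}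
    (hv : v.length = k) : sgn (g * h * g⁻¹ * h⁻¹) v = sgn h (g⁻¹ • v) * sgn h v := by
  rw [sgn_mul_of_mem _ (inv_mem hh) hv, sgn_conj g hh hv, sgn_inv, inv_mem hh v hv]

theorem loc_pow_of_mem {k : ℕ} {h : G} (hh : h ∈ levelKer G k) {v : List (Fin 3)}
    (hv : v.length = k) (n : ℕ) : loc (h ^ n) v = loc h v ^ n := by
  induction n with
  | zero => simp [loc_one]
  | succ n ih => rw [pow_succ, loc_mul_of_mem _ hh hv, ih, pow_succ]

/-- The alternating group on three letters has exponent 3. -/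
theorem mem_levelKer_succ_of_pow_three {k : ℕ} {g : G} (hg : g ∈ levelKer G k)
    (h : ∀ v : List (Fin 3), v.length = k → sgn g v = 1) : g ^ 3 ∈ levelKer G (k + 1) :=
  mem_levelKer_succ_iff.mpr ⟨pow_mem hg 3, fun v hv => by
    rw [loc_pow_of_mem hg hv, pow_three_of_sign _ (h v hv)]⟩

variable (G) in
/-- The kernel of the action on level `k` acts on level `k + 1` through all families of
permutations with trivial product of signs over siblings. -/
def Full (k : ℕ) : Prop :=
  ∀ π : List (Fin 3) → Equiv.Perm (Fin 3),
    (∀ v : List (Fin 3), v.length + 1 = k → ∏ a, Equiv.Perm.sign (π (a :: v)) = 1) →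
    ∃ h ∈ levelKer G k, ∀ v : List (Fin 3), v.length = k → loc h v = π v

theorem Full.exists_even {k : ℕ} (hk : Full G k) (π : List (Fin 3) → Equiv.Perm (Fin 3))
    (hπ : ∀ v, Equiv.Perm.sign (π v) = 1) :
    ∃ h ∈ levelKer G k, ∀ v : List (Fin 3), v.length = k → loc h v = π v :=
  hk π fun v _ => by simp [hπ]

/-! ### Paths from the root. -/

/-- A path from the root. -/
def IsPath (v : ℕ → List (Fin 3)) : Prop :=
  v 0 = [] ∧ ∀ j, ∃ a, v (j + 1) = a :: v j

namespace IsPath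

variable {v : ℕ → List (Fin 3)} (hv : IsPath v)
include hv

theorem length (j : ℕ) : (v j).length = j := by
  induction j with
  | zero => rw [hv.1]; rfl
  | succ j ih => obtain ⟨a, ha⟩ := hv.2 j; rw [ha, List.length_cons, ih]

theorem smul_eq_of_le {g : G} {j m : ℕ} (hjm : j ≤ m) (h : g • v m = v m) : g • v j = v j := by
  induction m, hjm using Nat.le_induction with
  | base => exact h
  | succ m _ ih =>
    obtain ⟨a, ha⟩ := hv.2 m
    rw [ha, smul_cons] at h
    exact ih (List.cons.inj h).2

end IsPath
/-- A permutation with prescribed sign. -/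
def permOfSign (e : ℤˣ) : Equiv.Perm (Fin 3) := if e = 1 then 1 else Equiv.swap 0 1

theorem sign_permOfSign (e : ℤˣ) : Equiv.Perm.sign (permOfSign e) = e := by
  rcases Int.units_eq_one_or e with rfl | rfl <;> decide

theorem units_mul_mul_mul_self : ∀ x y : ℤˣ, x * y * x * y = 1 := by decide

theorem units_mul_eq_of_mul_mul : ∀ x y z : ℤˣ, x * y * z = 1 → x * y = z := by decide

theorem units_eq_one_of_mul_mul : ∀ (s : Fin 3 → ℤˣ) (a : Fin 3), s 0 * s 1 * s 2 = 1 → s a = 1 →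
    (¬ ∀ b, b ≠ a → s b = -1) → ∀ b, s b = 1 := by decide

theorem exists_odd_apply :
    ∀ a : Fin 3, ∃ σ : Equiv.Perm (Fin 3), Equiv.Perm.sign σ = -1 ∧ σ a = a := by decide

theorem eq_swap_of_odd : ∀ (σ : Equiv.Perm (Fin 3)) (a : Fin 3), σ a = a →
    Equiv.Perm.sign σ = -1 → σ = Equiv.swap (a + 1) (a + 2) := by decide

theorem inv_smul_cons {k : ℕ} {g : G} (hg : g ∈ levelKer G k) {v : List (Fin 3)}
    (hv : v.length = k) (a : Fin 3) : g⁻¹ • (a :: v) = (loc g v)⁻¹ a :: v := by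
  rw [smul_cons, loc_inv_of_mem hg hv, inv_mem hg v hv]

theorem prod_sgn_of_mem (hS : ∀ (g : G) v, ∏ a, sgn g (a :: v) = sgn g v) {k : ℕ} {g : G}
    (hg : g ∈ levelKer G (k + 1)) {v : List (Fin 3)} (hv : v.length = k) :
    sgn g (0 :: v) * sgn g (1 :: v) * sgn g (2 :: v) = 1 := by
  rw [← Fin.prod_univ_three (fun a => sgn g (a :: v)), hS, sgn, loc_eq_one_of_mem hg (by omega),
    map_one]

/-! ### Correcting path-fixing elements by commutators. -/

section Path

variable {v : ℕ → List (Fin 3)}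

/-- Even permutations are already transitive on three letters, and even families are always
available in a full kernel. So an element fixing the path to level k can be made to fix it to level
m without changing the sign at `v k`. -/
theorem IsPath.exists_fixing (hv : IsPath v) {k m : ℕ} (hkm : k ≤ m)
    (hF : ∀ j, k ≤ j → j < m → Full G j) {g : G} (hg : g • v k = v k) :
    ∃ n ∈ levelKer G k, (g * n) • v m = v m ∧ sgn n (v k) = 1 := by
  induction m, hkm using Nat.le_induction with
  | base => exact ⟨1, one_mem _, by simpa using hg, sgn_one _⟩
  | succ m hkm ih =>
    obtain ⟨n, hn, hnm, hns⟩ := ih fun j h1 h2 => hF j h1 (h2.trans (Nat.lt_succ_self m))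
    obtain ⟨a, ha⟩ := hv.2 m
    obtain ⟨σ, hσ, hσa⟩ := exists_even_apply a ((loc (g * n) (v m))⁻¹ a)
    obtain ⟨n', hn', hn'l⟩ := (hF m hkm (Nat.lt_succ_self m)).exists_even
      (fun u => if u = v m then σ else 1) (fun u => by split_ifs <;> simp [hσ])
    have hloc : loc n' (v m) = σ := by rw [hn'l _ (hv.length m), if_pos rfl]
    refine ⟨n * n', mul_mem hn (levelKer_antitone hkm hn'), ?_, ?_⟩
    · rw [← mul_assoc, mul_smul, ha, smul_cons n', hn' _ (hv.length m), smul_cons, hnm, hloc, hσa]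
      simp
    · rw [sgn_mul_of_mem _ (levelKer_antitone hkm hn') (hv.length k), hns, one_mul]
      rcases hkm.eq_or_lt with rfl | hlt
      · rw [sgn, hloc, hσ]
      · rw [sgn, loc_eq_one_of_mem hn' (by rwa [hv.length]), map_one]

theorem IsPath.sgn_mul (hv : IsPath v) {j m : ℕ} (hjm : j ≤ m) (g : G) {h : G}
    (hh : h • v m = v m) : sgn (g * h) (v j) = sgn g (v j) * sgn h (v j) := by
  rw [IsTreeAction.sgn_mul, hv.smul_eq_of_le hjm hh]

theorem IsPath.sgn_commutator (hv : IsPath v) {j m : ℕ} (hjm : j ≤ m) {g h : G}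
    (hg : g • v m = v m) (hh : h • v m = v m) : sgn (g * h * g⁻¹ * h⁻¹) (v j) = 1 := by
  have hg' : g⁻¹ • v m = v m := by rw [inv_smul_eq_iff, hg]
  have hh' : h⁻¹ • v m = v m := by rw [inv_smul_eq_iff, hh]
  rw [hv.sgn_mul hjm _ hh', hv.sgn_mul hjm _ hg', hv.sgn_mul hjm _ hh, sgn_inv, sgn_inv,
    hv.smul_eq_of_le hjm hg', hv.smul_eq_of_le hjm hh']
  exact units_mul_mul_mul_self _ _

/-- Off the path, the signs of an element of the kernel of a level are those of a commutator of
elements that fix the path. -/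
theorem IsPath.exists_sgn_eq_off (hv : IsPath v) {k m : ℕ} (hkm : k + 1 < m)
    (hF : ∀ j < m, Full G j) (hS : ∀ (g : G) v, ∏ a, sgn g (a :: v) = sgn g v) {g : G}
    (hg : g ∈ levelKer G (k + 1)) :
    ∃ q ∈ levelKer G (k + 1), q • v m = v m ∧ (∀ j ≤ m, sgn q (v j) = 1) ∧
      (∀ u : List (Fin 3), u.length = k → u ≠ v k → ∀ a, sgn q (a :: u) = sgn g (a :: u)) ∧
      ∀ a, sgn q (a :: v k) = 1 := by
  -- `κ` rotates the children of every u ≠ `v k`, and `h` below carries the signs of g shifted by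
  -- one. At `a :: u` the commutator has the product of the signs of g at the other two children,
  -- which is the sign at a because all three multiply to 1.
  obtain ⟨κ, hκ, hκl⟩ := (hF k (by omega)).exists_even
    (fun u => if u = v k then 1 else rot)
    (fun u => by split_ifs <;> simp [sign_rot])
  have hκv : κ • v (k + 1) = v (k + 1) := by
    obtain ⟨a, ha⟩ := hv.2 k
    rw [ha, smul_cons, hκl _ (hv.length k), if_pos rfl, hκ _ (hv.length k)]; rfl
  obtain ⟨n, hn, hnm, -⟩ := hv.exists_fixing hkm.le (fun j _ hj => hF j hj) hκv
  let η : List (Fin 3) → Equiv.Perm (Fin 3) := fun w => match w with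
    | [] => 1
    | a :: u => if u = v k then 1 else permOfSign (sgn g ((a - 1) :: u))
  obtain ⟨h, hh, hhl⟩ := hF (k + 1) hkm η (by
    intro u hu
    have h3 := prod_sgn_of_mem hS hg (Nat.succ_injective hu)
    by_cases huv : u = v k
    · simp [η, huv]
    · have e0 : (0 - 1 : Fin 3) = 2 := by decide
      have e2 : (2 - 1 : Fin 3) = 1 := by decide
      simp only [η, if_neg huv, sign_permOfSign, Fin.prod_univ_three, e0, sub_self, e2]
      rw [← h3, mul_assoc, mul_comm])
  have hhv : h • v (k + 1 + 1) = v (k + 1 + 1) := by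
    obtain ⟨a, ha⟩ := hv.2 (k + 1)
    obtain ⟨b, hb⟩ := hv.2 k
    rw [ha, smul_cons, hhl _ (hv.length _), hh _ (hv.length _), hb]
    simp [η]
  obtain ⟨n', hn', hnm', -⟩ := hv.exists_fixing (by omega : k + 1 + 1 ≤ m)
    (fun j _ hj => hF j hj) hhv
  have hκn : κ * n ∈ levelKer G k := mul_mem hκ (levelKer_antitone (Nat.le_succ k) hn)
  have hhn : h * n' ∈ levelKer G (k + 1) := mul_mem hh (levelKer_antitone (Nat.le_succ _) hn')
  have hκn' : ∀ u : List (Fin 3), u.length = k → loc (κ * n) u = loc κ u := fun u hu => by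
    rw [loc_mul_of_mem _ (levelKer_antitone (Nat.le_succ k) hn) hu,
      loc_eq_one_of_mem hn (by omega), mul_one]
  have hhn' : ∀ u : List (Fin 3), u.length = k + 1 →
      sgn (h * n') u = Equiv.Perm.sign (η u) := fun u hu => by
    rw [sgn, loc_mul_of_mem _ (levelKer_antitone (Nat.le_succ _) hn') hu,
      loc_eq_one_of_mem hn' (by omega), mul_one, hhl u hu]
  refine ⟨_, commutator_mem (κ * n) hhn, ?_, fun j hj => hv.sgn_commutator hj hnm hnm', ?_, ?_⟩
  · rw [mul_smul, mul_smul, mul_smul, inv_smul_eq_iff.mpr hnm'.symm, inv_smul_eq_iff.mpr hnm.symm,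
      hnm', hnm]
  · intro u hu huv a
    rw [IsTreeAction.sgn_commutator _ hhn (by simp [hu]), inv_smul_cons hκn hu, hκn' u hu, hκl u hu,
      if_neg huv, hhn' _ (by simp [hu]), hhn' _ (by simp [hu]), rot_inv_apply]
    simp only [η, if_neg huv, sign_permOfSign]
    have h3 := prod_sgn_of_mem hS hg hu
    have e0 : (0 - 1 : Fin 3) = 2 := by decide
    have e2 : (2 - 1 : Fin 3) = 1 := by decide
    fin_cases a <;> simp only [Fin.zero_eta, Fin.mk_one, Fin.reduceFinMk, e0, e2, sub_self]
    · exact units_mul_eq_of_mul_mul _ _ _ (by rw [← h3, mul_comm, mul_assoc])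
    · exact units_mul_eq_of_mul_mul _ _ _ (by rw [← h3, mul_assoc, mul_comm])
    · exact units_mul_eq_of_mul_mul _ _ _ h3
  · intro a
    rw [IsTreeAction.sgn_commutator _ hhn (by simp [hv.length]), inv_smul_cons hκn (hv.length k),
      hhn' _ (by simp [hv.length]), hhn' _ (by simp [hv.length])]
    simp [η]

/-- The nontrivial sign vector next to the path that vanishes on the path is that of a commutator
of elements that fix the path. -/
theorem IsPath.exists_sgn_neg_beside (hv : IsPath v) {k m : ℕ} (hkm : k + 1 < m)
    (hF : ∀ j < m, Full G j)
    (hP : ∃ g : G, g • v k = v k ∧ sgn g (v k) = -1) {a : Fin 3} (ha : v (k + 1) = a :: v k) :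
    ∃ q ∈ levelKer G (k + 1), q • v m = v m ∧ (∀ j ≤ m, sgn q (v j) = 1) ∧
      (∀ u : List (Fin 3), u.length = k → u ≠ v k → ∀ b, sgn q (b :: u) = 1) ∧
      ∀ b, b ≠ a → sgn q (b :: v k) = -1 := by
  -- After correction by `n`, `κ` fixes the path and is odd at `v k`, so it swaps the children a + 1
  -- and a + 2. Taking `h` odd exactly at a and a + 1 makes the commutator odd exactly at a + 1 and
  -- a + 2. The odd permutation `τ` fixes the next path letter c, so `h` stays on the path.
  obtain ⟨κ, hκ, hκs⟩ := hP
  obtain ⟨n, hn, hnm, hns⟩ := hv.exists_fixing (by omega : k ≤ m) (fun j _ hj => hF j hj) hκ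
  obtain ⟨c, hc⟩ := hv.2 (k + 1)
  obtain ⟨τ, hτ, hτc⟩ := exists_odd_apply c
  let η : List (Fin 3) → Equiv.Perm (Fin 3) := fun w =>
    if w = a :: v k ∨ w = (a + 1) :: v k then τ else 1
  have hη : ∀ b, Equiv.Perm.sign (η (b :: v k)) = if b = a ∨ b = a + 1 then -1 else 1 := by
    intro b
    simp only [η, List.cons.injEq, and_true]
    split_ifs <;> simp [hτ]
  obtain ⟨h, hh, hhl⟩ := hF (k + 1) hkm η (by
    intro u hu
    by_cases huv : u = v k
    · subst huv
      simp only [hη]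
      clear * -
      revert a; decide
    · simp [η, huv])
  have hhv : h • v (k + 1 + 1) = v (k + 1 + 1) := by
    rw [hc, smul_cons, hhl _ (hv.length _), hh _ (hv.length _)]
    simp [η, ha, hτc]
  obtain ⟨n', hn', hnm', -⟩ := hv.exists_fixing (by omega : k + 1 + 1 ≤ m)
    (fun j _ hj => hF j hj) hhv
  have hhn : h * n' ∈ levelKer G (k + 1) := mul_mem hh (levelKer_succ_le _ hn')
  have hhn' : ∀ u : List (Fin 3), u.length = k + 1 →
      sgn (h * n') u = Equiv.Perm.sign (η u) := fun u hu => by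
    rw [sgn, loc_mul_of_mem _ (levelKer_succ_le _ hn') hu,
      loc_eq_one_of_mem hn' (by omega), mul_one, hhl u hu]
  have hκn : (κ * n)⁻¹ • v k = v k := by
    rw [inv_smul_eq_iff, hv.smul_eq_of_le (by omega) hnm]
  have hκa : loc (κ * n)⁻¹ (v k) = Equiv.swap (a + 1) (a + 2) := by
    have h1 : (κ * n)⁻¹ • v (k + 1) = v (k + 1) := by
      rw [inv_smul_eq_iff, hv.smul_eq_of_le (by omega) hnm]
    rw [ha, smul_cons, hκn] at h1
    refine eq_swap_of_odd _ _ (List.cons.inj h1).1 ?_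
    rw [← sgn, sgn_inv, hκn, sgn_mul_of_mem _ hn (hv.length k), hκs, hns, mul_one]
  refine ⟨_, commutator_mem (κ * n) hhn, ?_, fun j hj => hv.sgn_commutator hj hnm hnm', ?_, ?_⟩
  · rw [mul_smul, mul_smul, mul_smul, inv_smul_eq_iff.mpr hnm'.symm, inv_smul_eq_iff.mpr hnm.symm,
      hnm', hnm]
  · intro u hu huv b
    have hne : (κ * n)⁻¹ • u ≠ v k := fun h => huv (by rw [← hκn] at h; exact smul_left_cancel _ h)
    rw [IsTreeAction.sgn_commutator _ hhn (by simp [hu]), smul_cons,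
      hhn' _ (by simp [smul_length, hu]), hhn' _ (by simp [hu])]
    simp only [η, List.cons.injEq, huv, hne, and_false, or_self, if_false, map_one, mul_one]
  · intro b hb
    rw [IsTreeAction.sgn_commutator _ hhn (by simp [hv.length]), smul_cons, hκn, hκa,
      hhn' _ (by simp [hv.length]), hhn' _ (by simp [hv.length]), hη, hη]
    clear * - hb
    revert a b; decide

/-- One step in making an element that fixes the path trivial on higher levels. -/
theorem IsPath.exists_mem_levelKer_succ (hv : IsPath v) {k m : ℕ} (hkm : k < m)
    (hF : ∀ j < m, Full G j) (hS : ∀ (g : G) v, ∏ a, sgn g (a :: v) = sgn g v)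
    (hP : ∀ m, ∃ g : G, g • v m = v m ∧ sgn g (v m) = -1) {g : G} (hg : g ∈ levelKer G k)
    (hgm : g • v m = v m) (hgk : sgn g (v k) = 1) :
    ∃ g' ∈ levelKer G (k + 1), g' • v m = v m ∧ ∀ j ≤ m, sgn g' (v j) = sgn g (v j) := by
  -- Once all signs on level k are 1, cubing enters the next kernel; an odd power leaves the path
  -- signs unchanged.
  suffices h : ∃ q ∈ levelKer G k, q • v m = v m ∧ (∀ j ≤ m, sgn q (v j) = 1) ∧
      ∀ u : List (Fin 3), u.length = k → sgn (g * q) u = 1 by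
    obtain ⟨q, hq, hqm, hqs, hgq⟩ := h
    have hm : (g * q) • v m = v m := by rw [mul_smul, hqm, hgm]
    have hm2 : (g * q * (g * q)) • v m = v m := by rw [mul_smul, hm, hm]
    refine ⟨(g * q) ^ 3, mem_levelKer_succ_of_pow_three (mul_mem hg hq) hgq, ?_, fun j hj => ?_⟩
    · rw [pow_three', mul_smul, hm, hm2]
    · rw [pow_three', hv.sgn_mul hj _ hm, hv.sgn_mul hj _ hm, Int.units_mul_self, one_mul,
        hv.sgn_mul hj _ hqm, hqs j hj, mul_one]
  match k with
  | 0 =>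
    refine ⟨1, one_mem _, one_smul _ _, fun j _ => sgn_one _, fun u hu => ?_⟩
    rw [List.length_eq_zero_iff.mp hu, ← hv.1, mul_one, hgk]
  | k + 1 =>
    obtain ⟨a, ha⟩ := hv.2 k
    obtain ⟨q, hq, hqm, hqs, hq1, hq2⟩ := hv.exists_sgn_eq_off hkm hF hS hg
    obtain ⟨r, hr, hrm, hrs, hr1, hr2⟩ :=
      hv.exists_sgn_neg_beside hkm hF (hP k) ha
    have h3 := prod_sgn_of_mem hS hg (hv.length k)
    rw [ha] at hgk
    -- The sign at the path child is 1, so the other two agree. The extra factor `r` is needed only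
    -- when both are -1.
    by_cases hneg : ∀ b, b ≠ a → sgn g (b :: v k) = -1
    · have hrq : (q * r) • v m = v m := by rw [mul_smul, hrm, hqm]
      refine ⟨q * r, mul_mem hq hr, hrq, fun j hj => ?_, ?_⟩
      · rw [hv.sgn_mul hj _ hrm, hqs j hj, hrs j hj, one_mul]
      · intro u hu
        match u, hu with
        | b :: u, hu =>
          have hu' : u.length = k := by simpa using hu
          rw [sgn_mul_of_mem _ (mul_mem hq hr) hu, sgn_mul_of_mem _ hr hu]
          by_cases huv : u = v k
          · subst huv
            rw [hq2]
            by_cases hb : b = a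
            · subst hb
              have := hrs (k + 1) hkm.le
              rw [ha] at this
              rw [hgk, this, one_mul, one_mul]
            · rw [hneg b hb, hr2 b hb]; rfl
          · rw [hq1 u hu' huv, hr1 u hu' huv, mul_one, Int.units_mul_self]
    · refine ⟨q, hq, hqm, hqs, ?_⟩
      intro u hu
      match u, hu with
      | b :: u, hu =>
        have hu' : u.length = k := by simpa using hu
        rw [sgn_mul_of_mem _ hq hu]
        by_cases huv : u = v k
        · subst huv
          rw [hq2, mul_one]
          exact units_eq_one_of_mul_mul (fun b => sgn g (b :: v k)) a h3 hgk hneg b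
        · rw [hq1 u hu' huv, Int.units_mul_self]

end Path
-- The separating element for `v m` is pushed into one level kernel after another. Each push needs
-- sign 1 at the current path vertex, which is why the signs before m must be trivial.
theorem IsPath.exists_mem_levelKer_sgn_neg {v : ℕ → List (Fin 3)} (hv : IsPath v) {m : ℕ}
    (hF : ∀ j < m, Full G j) (hS : ∀ (g : G) v, ∏ a, sgn g (a :: v) = sgn g v)
    (hP : ∀ m, ∃ g : G, g • v m = v m ∧ (∀ j < m, sgn g (v j) = 1) ∧ sgn g (v m) = -1) :
    ∃ h ∈ levelKer G m, sgn h (v m) = -1 := by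
  suffices h : ∀ k ≤ m, ∃ h ∈ levelKer G k, h • v m = v m ∧ (∀ j < m, sgn h (v j) = 1) ∧
      sgn h (v m) = -1 by
    obtain ⟨h, hh, -, -, hs⟩ := h m le_rfl
    exact ⟨h, hh, hs⟩
  intro k hk
  induction k with
  | zero =>
    obtain ⟨g, hg⟩ := hP m
    exact ⟨g, mem_levelKer_zero g, hg⟩
  | succ k ih =>
    obtain ⟨g, hg, hgm, hgs, hgn⟩ := ih (by omega)
    obtain ⟨g', hg', hgm', hgs'⟩ := hv.exists_mem_levelKer_succ hk hF hS
      (fun m => (hP m).imp fun g h => ⟨h.1, h.2.2⟩) hg hgm (hgs k hk)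
    exact ⟨g', hg', hgm', fun j hj => by rw [hgs' j hj.le, hgs j hj], by rw [hgs' m le_rfl, hgn]⟩

/-! ### From one odd sign to all permitted families. -/

theorem units_even_eq_rotate : ∀ x e : Fin 3 → ℤˣ, x 0 * x 1 * x 2 = 1 → e 0 * e 1 * e 2 = 1 →
    (∃ a, x a = -1) → e = 1 ∨ ∃ i : Fin 3, ∀ a, e a = x (a - i) := by decide

theorem units_exists_neg_of_even : ∀ (x : Fin 3 → ℤˣ) (l : Fin 3), x 0 * x 1 * x 2 = 1 →
    x l = -1 → ∃ a, x (a - 1) * x a = -1 := by decide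

theorem finite_words (k : ℕ) : {v : List (Fin 3) | v.length = k}.Finite :=
  List.finite_length_eq (Fin 3) k

/-- An element of the kernel of level `k + 1` with a single nontrivial sign vector. -/
theorem exists_sgn_single {k : ℕ} (hF : Full G k)
    (hS : ∀ (g : G) v, ∏ a, sgn g (a :: v) = sgn g v)
    (hT : ∀ u v : List (Fin 3), u.length = v.length → ∃ g : G, g • u = v)
    {h : G} (hh : h ∈ levelKer G (k + 1)) {u : List (Fin 3)} (hu : u.length = k) {l : Fin 3}
    (hl : sgn h (l :: u) = -1) {w : List (Fin 3)} (hw : w.length = k) (e : Fin 3 → ℤˣ)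
    (he : e 0 * e 1 * e 2 = 1) :
    ∃ q ∈ levelKer G (k + 1), (∀ a, sgn q (a :: w) = e a) ∧
      ∀ w' : List (Fin 3), w'.length = k → w' ≠ w → ∀ a, sgn q (a :: w') = 1 := by
  obtain ⟨g, hg⟩ := hT (l :: u) (0 :: w) (by simp [hu, hw])
  set h1 := g * h * g⁻¹ with h1_def
  have hh1 : h1 ∈ levelKer G (k + 1) := Subgroup.Normal.conj_mem inferInstance h hh g
  have hl1 : sgn h1 (0 :: w) = -1 := by
    rw [h1_def, sgn_conj g hh (by simp [hw]), ← hg, inv_smul_smul, hl]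
  obtain ⟨κ, hκ, hκl⟩ := hF.exists_even (fun u => if u = w then rot else 1)
    (fun u => by split_ifs <;> simp [sign_rot])
  have hκw : loc κ w = rot := by rw [hκl w hw, if_pos rfl]
  -- `κ` moves only the children of w, so the commutator has trivial signs under every other parent.
  -- Under w it stays nontrivial, because a nontrivial sign vector of product 1 is not constant.
  set h2 := κ * h1 * κ⁻¹ * h1⁻¹ with h2_def
  have hh2 : h2 ∈ levelKer G (k + 1) := commutator_mem κ hh1
  have h2w : ∀ a, sgn h2 (a :: w) = sgn h1 ((a - 1) :: w) * sgn h1 (a :: w) := fun a => by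
    rw [h2_def, sgn_commutator κ hh1 (by simp [hw]), inv_smul_cons hκ hw, hκw, rot_inv_apply]
  have h2w' : ∀ w' : List (Fin 3), w'.length = k → w' ≠ w → ∀ a, sgn h2 (a :: w') = 1 := by
    intro w' hw' hne a
    rw [h2_def, sgn_commutator κ hh1 (by simp [hw']), inv_smul_cons hκ hw', hκl w' hw', if_neg hne]
    exact Int.units_mul_self _
  -- The nontrivial even vectors form a single orbit under rotation, so conjugating by powers of `κ`
  -- reaches all of them.
  rcases units_even_eq_rotate (fun a => sgn h2 (a :: w)) e (prod_sgn_of_mem hS hh2 hw) he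
    (by simp only [h2w]; exact units_exists_neg_of_even (fun a => sgn h1 (a :: w)) 0
          (prod_sgn_of_mem hS hh1 hw) hl1) with rfl | ⟨i, hi⟩
  · exact ⟨1, one_mem _, fun a => sgn_one _, fun w' _ _ a => sgn_one _⟩
  · have hκi := pow_mem hκ i.val
    refine ⟨κ ^ i.val * h2 * (κ ^ i.val)⁻¹, Subgroup.Normal.conj_mem inferInstance h2 hh2 _,
      fun a => ?_, fun w' hw' hne a => ?_⟩
    · rw [sgn_conj _ hh2 (by simp [hw]), inv_smul_cons hκi hw, loc_pow_of_mem hκ hw, hκw, hi]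
      congr 2
      clear * -
      revert a i; decide
    · rw [sgn_conj _ hh2 (by simp [hw']), inv_smul_cons hκi hw', h2w' w' hw' hne]

/-- All even sign vectors occur on a level as soon as one sign is nontrivial. -/
theorem exists_sgn_eq {m : ℕ} (hF : ∀ j < m, Full G j)
    (hS : ∀ (g : G) v, ∏ a, sgn g (a :: v) = sgn g v)
    (hT : ∀ u v : List (Fin 3), u.length = v.length → ∃ g : G, g • u = v)
    {h : G} (hh : h ∈ levelKer G m) {u : List (Fin 3)} (hu : u.length = m)
    (hl : sgn h u = -1) (e : List (Fin 3) → ℤˣ)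
    (he : ∀ v : List (Fin 3), v.length + 1 = m → e (0 :: v) * e (1 :: v) * e (2 :: v) = 1) :
    ∃ q ∈ levelKer G m, ∀ v : List (Fin 3), v.length = m → sgn q v = e v := by
  match m, u, hu with
  | 0, [], _ =>
    rcases Int.units_eq_one_or (e []) with h1 | h1
    · exact ⟨1, one_mem _, fun v hv => by rw [List.length_eq_zero_iff.mp hv, h1, sgn_one]⟩
    · exact ⟨h, hh, fun v hv => by rw [List.length_eq_zero_iff.mp hv, h1, hl]⟩
  | k + 1, l :: u, hu =>
    have hu' : u.length = k := by simpa using hu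
    suffices hs : ∀ S : Finset (List (Fin 3)), (∀ w ∈ S, w.length = k) →
        ∃ q ∈ levelKer G (k + 1), ∀ w : List (Fin 3), w.length = k → ∀ a,
          sgn q (a :: w) = if w ∈ S then e (a :: w) else 1 by
      obtain ⟨q, hq, hqs⟩ := hs (finite_words k).toFinset (by simp)
      refine ⟨q, hq, fun v hv => ?_⟩
      match v, hv with
      | a :: w, hv =>
        have hw : w.length = k := by simpa using hv
        rw [hqs w hw, if_pos (by simpa using hw)]
    intro S
    induction S using Finset.induction_on with
    | empty => exact fun _ => ⟨1, one_mem _, fun w _ a => by simp [sgn_one]⟩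
    | insert x S hx ih =>
      intro hS'
      obtain ⟨q, hq, hqs⟩ := ih fun w hw => hS' w (Finset.mem_insert_of_mem hw)
      have hxk := hS' x (Finset.mem_insert_self x S)
      obtain ⟨r, hr, hr1, hr2⟩ := exists_sgn_single (hF k (Nat.lt_succ_self k)) hS hT hh hu' hl hxk
        (fun a => e (a :: x)) (he x (by rw [hxk]))
      refine ⟨q * r, mul_mem hq hr, fun w hw a => ?_⟩
      rw [sgn_mul_of_mem q hr (by simp [hw]), hqs w hw]
      by_cases hwx : w = x
      · subst hwx; simp [hx, hr1]
      · rw [hr2 w hw hwx, mul_one]; simp [hwx]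

theorem exists_apply_eq_of_odd : ∀ σ : Equiv.Perm (Fin 3), Equiv.Perm.sign σ = -1 →
    ∃ a b, a ≠ b ∧ σ a = a ∧ σ b ≠ b := by decide

theorem eq_pow_of_sign : ∀ σ τ : Equiv.Perm (Fin 3), σ ≠ 1 → Equiv.Perm.sign σ = 1 →
    Equiv.Perm.sign τ = 1 → ∃ i : Fin 3, τ = σ ^ i.val := by decide

set_option maxRecDepth 4000 in
theorem mul_conj_pow_four : ∀ (σ τ : Equiv.Perm (Fin 3)) (a b : Fin 3), Equiv.Perm.sign σ = -1 →
    σ a = a → a ≠ b → τ a = b → (σ * (τ * σ * τ⁻¹)) ^ 4 ≠ 1 := by decide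

theorem sign_pow_four : ∀ σ : Equiv.Perm (Fin 3), Equiv.Perm.sign (σ ^ 4) = 1 := by decide

theorem commutator_of_sign : ∀ σ τ : Equiv.Perm (Fin 3), Equiv.Perm.sign τ = 1 →
    σ * τ * σ⁻¹ * τ⁻¹ = if Equiv.Perm.sign σ = 1 then 1 else τ := by decide

/-- An element acting on level `m + 1` as a `3`-cycle below one vertex, and trivially elsewhere. -/
theorem exists_loc_single {m : ℕ}
    (hE : ∀ e : List (Fin 3) → ℤˣ, (∀ v : List (Fin 3), v.length + 1 = m →
      e (0 :: v) * e (1 :: v) * e (2 :: v) = 1) →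
      ∃ q ∈ levelKer G m, ∀ v : List (Fin 3), v.length = m → sgn q v = e v)
    (hT : ∀ u v : List (Fin 3), u.length = v.length → ∃ g : G, g • u = v)
    {h : G} (hh : h ∈ levelKer G m) {u : List (Fin 3)} (hu : u.length = m)
    (hl : sgn h u = -1) {τ : Equiv.Perm (Fin 3)} (hτ : Equiv.Perm.sign τ = 1) :
    ∃ q ∈ levelKer G m, loc q u = τ ∧
      ∀ w : List (Fin 3), w.length = m → w ≠ u → loc q w = 1 := by
  obtain ⟨a, b, hab, ha, -⟩ := exists_apply_eq_of_odd _ hl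
  obtain ⟨g, hg⟩ := hT (a :: u) (b :: u) (by simp)
  rw [smul_cons] at hg
  obtain ⟨hga, hgu⟩ := List.cons.inj hg
  have hgh : g * h * g⁻¹ ∈ levelKer G m := Subgroup.Normal.conj_mem inferInstance h hh g
  -- At u this multiplies two distinct transpositions, one fixing a and one fixing b, giving a
  -- 3-cycle. The fourth power preserves 3-cycles and kills transpositions, so all local
  -- permutations become even.
  set h1 := (h * (g * h * g⁻¹)) ^ 4 with h1_def
  have hh1 : h1 ∈ levelKer G m := pow_mem (mul_mem hh hgh) 4
  have h1s : ∀ w : List (Fin 3), w.length = m → Equiv.Perm.sign (loc h1 w) = 1 := fun w hw => by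
    rw [h1_def, loc_pow_of_mem (mul_mem hh hgh) hw, sign_pow_four]
  have h1u : loc h1 u ≠ 1 := by
    have : g⁻¹ • u = u := by rw [inv_smul_eq_iff, hgu]
    rw [h1_def, loc_pow_of_mem (mul_mem hh hgh) hu, loc_mul_of_mem h hgh hu, loc_conj g hh hu, this]
    exact mul_conj_pow_four _ _ a b hl ha hab hga
  -- An odd permutation inverts an even τ, so their commutator is τ^(-2) = τ; an even one commutes
  -- with it. Commutators with k thus restrict t to the vertices where k is odd.
  have comm : ∀ (k t : G), k ∈ levelKer G m → t ∈ levelKer G m →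
      (∀ w : List (Fin 3), w.length = m → Equiv.Perm.sign (loc t w) = 1) →
      ∀ w : List (Fin 3), w.length = m → loc (k * t * k⁻¹ * t⁻¹) w =
        if sgn k w = 1 then 1 else loc t w := by
    intro k t hk ht hts w hw
    rw [loc_mul_of_mem _ (inv_mem ht) hw, loc_mul_of_mem _ (inv_mem hk) hw, loc_mul_of_mem _ ht hw,
      loc_inv_of_mem hk hw, loc_inv_of_mem ht hw, commutator_of_sign _ _ (hts w hw), sgn]
  have key : ∃ h2 ∈ levelKer G m, loc h2 u ≠ 1 ∧ Equiv.Perm.sign (loc h2 u) = 1 ∧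
      ∀ w : List (Fin 3), w.length = m → w ≠ u → loc h2 w = 1 := by
    match m, u, hu with
    | 0, [], _ => exact ⟨h1, hh1, h1u, h1s _ rfl, fun w hw hne =>
        absurd (List.length_eq_zero_iff.mp hw) hne⟩
    | k + 1, l :: u, hu =>
      have hE' : ∀ i : Fin 3, i ≠ 0 → ∃ q ∈ levelKer G (k + 1), ∀ v : List (Fin 3),
          v.length = k + 1 → sgn q v = if v = l :: u ∨ v = (l + i) :: u then -1 else 1 := by
        intro i hi
        refine hE _ fun v hv => ?_
        by_cases hvu : v = u
        · subst hvu
          simp only [List.cons.injEq, and_true]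
          clear * - hi
          revert l i; decide
        · simp [hvu]
      -- The relation forces odd vertices to come in pairs of siblings. The two pairs chosen here
      -- meet only in `l :: u`, so two successive commutators isolate that vertex.
      obtain ⟨k1, hk1, hk1s⟩ := hE' 1 (by decide)
      obtain ⟨k2, hk2, hk2s⟩ := hE' 2 (by decide)
      have ht : k1 * h1 * k1⁻¹ * h1⁻¹ ∈ levelKer G (k + 1) := commutator_mem k1 hh1
      have htl := comm k1 h1 hk1 hh1 h1s
      have hts : ∀ w : List (Fin 3), w.length = k + 1 →
          Equiv.Perm.sign (loc (k1 * h1 * k1⁻¹ * h1⁻¹) w) = 1 := fun w hw => by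
        rw [htl w hw]; split_ifs
        · exact map_one _
        · exact h1s w hw
      have hql := comm k2 _ hk2 ht hts
      have hqu : loc (k2 * (k1 * h1 * k1⁻¹ * h1⁻¹) * k2⁻¹ * (k1 * h1 * k1⁻¹ * h1⁻¹)⁻¹) (l :: u) =
          loc h1 (l :: u) := by
        rw [hql _ hu, htl _ hu, hk1s _ hu, hk2s _ hu]
        simp
      refine ⟨_, commutator_mem k2 ht, by rw [hqu]; exact h1u, by rw [hqu]; exact h1s _ hu,
        fun w hw hne => ?_⟩
      rw [hql w hw, htl w hw, hk1s w hw, hk2s w hw]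
      by_cases hw2 : w = (l + 2) :: u
      · subst hw2; simp
      · simp [hne, hw2]
  obtain ⟨h2, hh2, h2u, h2s, h2w⟩ := key
  rcases eq_pow_of_sign _ τ h2u h2s hτ with ⟨i, rfl⟩
  exact ⟨h2 ^ i.val, pow_mem hh2 _, loc_pow_of_mem hh2 hu _, fun w hw hne => by
    rw [loc_pow_of_mem hh2 hw, h2w w hw hne, one_pow]⟩

/-- First realize the signs of the prescribed family. The remaining discrepancy is an even
permutation at each vertex, removed one vertex at a time by elements supported there. -/
theorem full_of_sgn {m : ℕ} (hF : ∀ j < m, Full G j)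
    (hS : ∀ (g : G) v, ∏ a, sgn g (a :: v) = sgn g v)
    (hT : ∀ u v : List (Fin 3), u.length = v.length → ∃ g : G, g • u = v)
    {h : G} (hh : h ∈ levelKer G m) {u : List (Fin 3)} (hu : u.length = m)
    (hl : sgn h u = -1) : Full G m := by
  have hE := exists_sgn_eq hF hS hT hh hu hl
  have hodd : ∀ w : List (Fin 3), w.length = m → ∃ h ∈ levelKer G m, sgn h w = -1 := by
    intro w hw
    obtain ⟨g, hg⟩ := hT u w (hu.trans hw.symm)
    refine ⟨g * h * g⁻¹, Subgroup.Normal.conj_mem inferInstance h hh g, ?_⟩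
    rw [sgn_conj g hh hw, ← hg, inv_smul_smul, hl]
  intro π hπ
  obtain ⟨q, hq, hqs⟩ := hE (fun v => Equiv.Perm.sign (π v)) fun v hv => by
    rw [← hπ v hv, Fin.prod_univ_three]
  suffices hs : ∀ S : Finset (List (Fin 3)), (∀ w ∈ S, w.length = m) →
      ∃ r ∈ levelKer G m, ∀ w : List (Fin 3), w.length = m →
        loc r w = if w ∈ S then (loc q w)⁻¹ * π w else 1 by
    obtain ⟨r, hr, hrl⟩ := hs (finite_words m).toFinset (by simp)
    refine ⟨q * r, mul_mem hq hr, fun v hv => ?_⟩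
    rw [loc_mul_of_mem q hr hv, hrl v hv, if_pos (by simpa using hv), mul_inv_cancel_left]
  intro S
  induction S using Finset.induction_on with
  | empty => exact fun _ => ⟨1, one_mem _, fun w _ => by simp [loc_one]⟩
  | insert x S hx ih =>
    intro hS'
    obtain ⟨r, hr, hrl⟩ := ih fun w hw => hS' w (Finset.mem_insert_of_mem hw)
    have hxk := hS' x (Finset.mem_insert_self x S)
    obtain ⟨h', hh', hs'⟩ := hodd x hxk
    obtain ⟨t, ht, ht1, ht2⟩ := exists_loc_single hE hT hh' hxk hs'
      (τ := (loc q x)⁻¹ * π x) (by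
        have := hqs x hxk
        rw [sgn] at this
        rw [map_mul, map_inv, this, inv_mul_cancel])
    refine ⟨r * t, mul_mem hr ht, fun w hw => ?_⟩
    rw [loc_mul_of_mem r ht hw, hrl w hw]
    by_cases hwx : w = x
    · subst hwx; simp [hx, ht1]
    · rw [ht2 w hw hwx, mul_one]; simp [hwx]

/-- A group acting on the ternary tree with the sign relation is as large as possible if it is
transitive on the levels and the signs along a path are independent. -/
theorem full_of_path {v : ℕ → List (Fin 3)} (hv : IsPath v)
    (hS : ∀ (g : G) v, ∏ a, sgn g (a :: v) = sgn g v)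
    (hT : ∀ u v : List (Fin 3), u.length = v.length → ∃ g : G, g • u = v)
    (hP : ∀ m, ∃ g : G, g • v m = v m ∧ (∀ j < m, sgn g (v j) = 1) ∧ sgn g (v m) = -1)
    (m : ℕ) : Full G m := by
  induction m using Nat.strong_induction_on with
  | _ m ih =>
    obtain ⟨h, hh, hl⟩ := hv.exists_mem_levelKer_sgn_neg ih hS hP
    exact full_of_sgn ih hS hT hh (hv.length m) hl

end IsTreeAction

/-! ### Finite trees -/

namespace treeAut

open IsTreeAction

variable {n : ℕ}

/-- The action of an automorphism of `T_n(3)` on the last `n` letters of a word. -/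
def act (σ : treeAut 3 n) : List (Fin 3) → List (Fin 3)
  | [] => []
  | a :: v => if h : (a :: v).length ≤ n then (σ.1 ⟨a :: v, h⟩).1 else a :: act σ v

theorem act_of_le (σ : treeAut 3 n) (v : List (Fin 3)) (h : v.length ≤ n) :
    act σ v = (σ.1 ⟨v, h⟩).1 := by
  match v with
  | [] =>
    have := treeAut_length σ ⟨[], h⟩
    exact (List.length_eq_zero_iff.mp this).symm
  | a :: v => rw [act, dif_pos h]

theorem act_of_gt (σ : treeAut 3 n) (a : Fin 3) (v : List (Fin 3)) (h : ¬ (a :: v).length ≤ n) :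
    act σ (a :: v) = a :: act σ v := by
  rw [act, dif_neg h]

theorem length_act (σ : treeAut 3 n) (v : List (Fin 3)) : (act σ v).length = v.length := by
  induction v with
  | nil => rfl
  | cons a v ih =>
    by_cases h : (a :: v).length ≤ n
    · rw [act_of_le σ _ h, treeAut_length]
    · rw [act_of_gt σ a v h, List.length_cons, List.length_cons, ih]

instance : MulAction (treeAut 3 n) (List (Fin 3)) where
  smul := act
  one_smul v := by
    change act 1 v = v
    induction v with
    | nil => rfl
    | cons a v ih =>
      by_cases h : (a :: v).length ≤ n
      · rw [act_of_le _ _ h]; rfl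
      · rw [act_of_gt _ a v h, ih]
  mul_smul σ τ v := by
    change act (σ * τ) v = act σ (act τ v)
    induction v with
    | nil => rfl
    | cons a v ih =>
      by_cases h : (a :: v).length ≤ n
      · rw [act_of_le _ _ h, act_of_le σ _ (by rwa [length_act])]
        have : (⟨act τ (a :: v), by rwa [length_act]⟩ : TreeVertex 3 n) = τ.1 ⟨a :: v, h⟩ :=
          Subtype.ext (act_of_le τ _ h)
        rw [this]; rfl
      · rw [act_of_gt _ a v h, act_of_gt _ a v h, ih, act_of_gt]
        simpa [length_act] using h

theorem smul_of_le (σ : treeAut 3 n) (v : List (Fin 3)) (h : v.length ≤ n) :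
    σ • v = (σ.1 ⟨v, h⟩).1 := act_of_le σ v h

instance : IsTreeAction (treeAut 3 n) where
  smul_length := length_act
  smul_tail σ v := by
    match v with
    | [] => rfl
    | a :: v =>
      by_cases h : (a :: v).length ≤ n
      · rw [smul_of_le _ _ h, List.tail_cons, smul_of_le _ _ ((Nat.le_succ _).trans h)]
        exact congrArg Subtype.val (σ.2 ⟨a :: v, h⟩).symm
      · change (act σ (a :: v)).tail = act σ v
        rw [act_of_gt σ a v h, List.tail_cons]

theorem ext_smul {σ τ : treeAut 3 n} (h : ∀ v : List (Fin 3), v.length ≤ n → σ • v = τ • v) :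
    σ = τ := by
  apply Subtype.ext
  ext1 v
  apply Subtype.ext
  rw [← smul_of_le σ v.1 v.2, ← smul_of_le τ v.1 v.2, h v.1 v.2]

/-- The words of length two as pairs of letters. -/
def levelTwoEquiv (hn : 2 ≤ n) :
    {v : TreeVertex 3 n // v.1.length = 2} ≃ Fin 3 × Fin 3 where
  toFun v := (v.1.1[0]'(by rw [v.2]; decide), v.1.1[1]'(by rw [v.2]; decide))
  invFun x := ⟨⟨[x.1, x.2], hn⟩, rfl⟩
  left_inv v := Subtype.ext (Subtype.ext (by
    obtain ⟨a, b, h⟩ := List.length_eq_two.mp v.2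
    simp [h]))
  right_inv x := rfl

/-- On pairs of letters the action is a permutation within each sibling family followed by three
parallel copies of the root permutation; the sign of the latter is cubed, hence unchanged. -/
theorem restrictedSign_two (hn : 2 ≤ n) (σ : treeAut 3 n) :
    restrictedSign 3 n 2 σ = sgn σ [] * ∏ a, sgn σ [a] := by
  have h : ∀ v, levelTwoEquiv hn (levelPerm 3 n 2 σ v) =
      (Equiv.prodCongrRight (fun _ : Fin 3 => loc σ []) *
        Equiv.prodCongrLeft (fun a : Fin 3 => loc σ [a]) : Equiv.Perm (Fin 3 × Fin 3))
        (levelTwoEquiv hn v) := by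
    intro v
    obtain ⟨⟨a, b⟩, rfl⟩ := (levelTwoEquiv hn).symm.surjective v
    rw [← Equiv.eq_symm_apply]
    apply Subtype.ext
    apply Subtype.ext
    have h1 := smul_of_le σ [a, b] hn
    rw [smul_cons, smul_cons, smul_nil] at h1
    exact h1.symm
  rw [restrictedSign, MonoidHom.comp_apply, Equiv.Perm.sign_eq_sign_of_equiv _ _ _ h, map_mul,
    Equiv.Perm.sign_prodCongrRight, Equiv.Perm.sign_prodCongrLeft, Fin.prod_const]
  rw [pow_three, Int.units_mul_self, mul_one]
  rfl

theorem exists_smul_append (σ : treeAut 3 (n + 1)) (i : Fin 3) (w : List (Fin 3)) :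
    ∃ u, σ • (w ++ [i]) = u ++ [loc σ [] i] := by
  induction w with
  | nil => exact ⟨[], by rw [List.nil_append, smul_cons, smul_nil]; rfl⟩
  | cons c w ih =>
    obtain ⟨u, hu⟩ := ih
    exact ⟨loc σ (w ++ [i]) c :: u, by rw [List.cons_append, smul_cons, hu]; rfl⟩

/-- Every automorphism of `T_{n+1}(3)` is an element of the wreath product. -/
theorem exists_sub (σ : treeAut 3 (n + 1)) : ∃ b : Fin 3 → treeAut 3 n,
    ∀ (i : Fin 3) (w : TreeVertex 3 n), σ.1 (w.under i) = ((b i).1 w).under (loc σ [] i) := by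
  choose s hs using exists_smul_append σ
  have hlen : ∀ i w, (s i w).length = w.length := by
    intro i w
    have := congrArg List.length (hs i w)
    rw [smul_length] at this
    simpa using this.symm
  let f : Fin 3 → TreeVertex 3 n → TreeVertex 3 n := fun i w => ⟨s i w.1, by rw [hlen]; exact w.2⟩
  have hf : ∀ i, Function.Injective (f i) := by
    intro i w w' h
    have h1 : s i w.1 = s i w'.1 := congrArg Subtype.val h
    have h2 : σ • (w.1 ++ [i]) = σ • (w'.1 ++ [i]) := by rw [hs, hs, h1]
    exact Subtype.ext (List.append_cancel_right (smul_left_cancel _ h2))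
  refine ⟨fun i => ⟨Equiv.ofBijective (f i) (Finite.injective_iff_bijective.mp (hf i)), ?_⟩, ?_⟩
  · intro w
    apply Subtype.ext
    change s i w.1.tail = (s i w.1).tail
    rcases w with ⟨_ | ⟨c, w⟩, hw⟩
    · rw [List.length_eq_zero_iff.mp (hlen i [])]
      exact List.length_eq_zero_iff.mp (hlen i _)
    · have h1 := hs i (c :: w)
      rw [List.cons_append, smul_cons, hs] at h1
      have h2 : (loc σ (w ++ [i]) c :: s i w) ++ [loc σ [] i] = s i (c :: w) ++ [loc σ [] i] := h1
      rw [← List.append_cancel_right h2]; rfl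
  · intro i w
    apply Subtype.ext
    rw [← smul_of_le σ (w.under i).1 (w.under i).2]
    exact hs i w.1

theorem loc_append {σ : treeAut 3 (n + 1)} {b : treeAut 3 n} {i j : Fin 3}
    (h : ∀ w : TreeVertex 3 n, σ.1 (w.under i) = (b.1 w).under j) {w : List (Fin 3)}
    (hw : w.length < n) : loc σ (w ++ [i]) = loc b w := by
  have hσ : ∀ w : List (Fin 3), w.length ≤ n → σ • (w ++ [i]) = b • w ++ [j] := by
    intro w hw
    rw [smul_of_le σ _ (by simpa using hw), smul_of_le b _ hw]
    exact congrArg Subtype.val (h ⟨w, hw⟩)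
  refine loc_eq fun a => ?_
  rw [← List.cons_append, hσ _ hw.le, hσ (a :: w) hw, smul_cons]; rfl

/-- Unrolling the recursion, the kernel of `sgn_2` is the relation at the root, and the wreath
factor imposes the relation at the vertices `w ++ [i]` through the section at i. -/
theorem mem_treeE_iff (σ : treeAut 3 n) : σ ∈ treeE 3 2 n ↔
    ∀ v : List (Fin 3), v.length + 2 ≤ n → ∏ a, sgn σ (a :: v) = sgn σ v := by
  induction n with
  | zero => exact iff_of_true trivial fun v hv => by omega
  | succ n ih =>
    rw [treeE]
    split_ifs with hn
    · exact iff_of_true trivial fun v hv => by omega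
    · rw [Subgroup.mem_inf, MonoidHom.mem_ker, restrictedSign_two (by omega)]
      constructor
      · rintro ⟨⟨b, a, hb, hσ⟩, hs⟩ v hv
        rcases List.eq_nil_or_concat v with rfl | ⟨w, i, rfl⟩
        · rw [← mul_right_inj (sgn σ []), hs, Int.units_mul_self]
        · have hw : w.length + 2 ≤ n := by simpa using hv
          have := (ih (b i)).mp (hb i) w hw
          simp only [sgn, List.concat_eq_append, ← List.cons_append] at this ⊢
          rw [loc_append (hσ i) (by omega), ← this]
          refine Finset.prod_congr rfl fun c _ => ?_
          rw [loc_append (hσ i) (by simp; omega)]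
      · intro h
        refine ⟨?_, by rw [h [] (by simp; omega), Int.units_mul_self]⟩
        obtain ⟨b, hb⟩ := exists_sub σ
        refine ⟨b, loc σ [], fun i => (ih (b i)).mpr fun w hw => ?_, hb⟩
        have := h (w ++ [i]) (by simp; omega)
        simp only [sgn, ← List.cons_append] at this ⊢
        rw [loc_append (hb i) (by omega)] at this
        rw [← this]
        refine Finset.prod_congr rfl fun c _ => ?_
        rw [loc_append (hb i) (by simp; omega)]

end treeAut

/-! ### The image in the automorphism group of a finite tree. -/

namespace IsTreeAction

variable {G : Type*} [Group G] [MulAction G (List (Fin 3))] [IsTreeAction G]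

variable (G) in
/-- The action on the words of length at most `n`. -/
def toTreeAut (n : ℕ) : G →* treeAut 3 n where
  toFun g := ⟨
    { toFun := fun v => ⟨g • v.1, by rw [smul_length]; exact v.2⟩
      invFun := fun v => ⟨g⁻¹ • v.1, by rw [smul_length]; exact v.2⟩
      left_inv := fun v => Subtype.ext (inv_smul_smul _ _)
      right_inv := fun v => Subtype.ext (smul_inv_smul _ _) },
    fun v => Subtype.ext (smul_tail g v.1).symm⟩
  map_one' := Subtype.ext (Equiv.ext fun v => Subtype.ext (one_smul _ _))
  map_mul' g h := Subtype.ext (Equiv.ext fun v => Subtype.ext (mul_smul _ _ _))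

theorem toTreeAut_smul {n : ℕ} (g : G) {v : List (Fin 3)} (hv : v.length ≤ n) :
    toTreeAut G n g • v = g • v := treeAut.smul_of_le _ v hv

theorem loc_toTreeAut {n : ℕ} (g : G) {v : List (Fin 3)} (hv : v.length < n) :
    loc (toTreeAut G n g) v = loc g v :=
  loc_eq fun a => by rw [toTreeAut_smul g hv, toTreeAut_smul g hv.le, smul_cons]

theorem ker_toTreeAut (n : ℕ) : (toTreeAut G n).ker = levelKer G n := by
  ext g
  rw [MonoidHom.mem_ker]
  constructor
  · intro h v hv
    rw [← toTreeAut_smul g hv.le, h, one_smul]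
  · intro h
    refine treeAut.ext_smul fun v hv => ?_
    rw [toTreeAut_smul g hv, one_smul, levelKer_antitone hv h v rfl]

theorem range_toTreeAut (hS : ∀ (g : G) v, ∏ a, sgn g (a :: v) = sgn g v)
    (hF : ∀ m, Full G m) (n : ℕ) : (toTreeAut G n).range = treeE 3 2 n := by
  apply le_antisymm
  · rintro _ ⟨g, rfl⟩
    rw [treeAut.mem_treeE_iff]
    intro v hv
    simp only [sgn]
    rw [loc_toTreeAut g (by omega)]
    simp only [sgn] at hS
    rw [← hS]
    exact Finset.prod_congr rfl fun a _ => by rw [loc_toTreeAut g (by simp; omega)]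
  · intro σ hσ
    rw [treeAut.mem_treeE_iff] at hσ
    suffices h : ∀ k ≤ n, ∃ g : G, ∀ v : List (Fin 3), v.length ≤ k → g • v = σ • v by
      obtain ⟨g, hg⟩ := h n le_rfl
      exact ⟨g, treeAut.ext_smul fun v hv => by rw [toTreeAut_smul g hv, hg v hv]⟩
    intro k hk
    induction k with
    | zero => exact ⟨1, fun v hv => by
        rw [List.length_eq_zero_iff.mp (Nat.le_zero.mp hv), smul_nil, smul_nil]⟩
    | succ k ih =>
      obtain ⟨g, hg⟩ := ih (by omega)
      have hloc : ∀ v : List (Fin 3), v.length < k → loc g v = loc σ v := fun v hv =>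
        loc_eq fun a => by rw [hg v hv.le, hg (a :: v) hv, smul_cons]
      -- This family is permitted: g and σ both satisfy the sign relation and have the same local
      -- permutations above level k.
      obtain ⟨h, hh, hhl⟩ := hF k (fun v => (loc g v)⁻¹ * loc σ v) (by
        intro v hv
        have h1 := hS g v
        rw [sgn, hloc v (by omega), ← sgn, ← hσ v (by omega)] at h1
        simp only [map_mul, map_inv, Finset.prod_mul_distrib, Finset.prod_inv_distrib]
        rw [inv_mul_eq_one]
        exact h1)
      refine ⟨g * h, fun v hv => ?_⟩
      rcases hv.lt_or_eq with hlt | heq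
      · rw [mul_smul, levelKer_antitone (Nat.lt_succ_iff.mp hlt) hh v rfl,
          hg v (Nat.lt_succ_iff.mp hlt)]
      · match v, heq with
        | a :: v, heq =>
          have hv' : v.length = k := by simpa using heq
          rw [smul_cons, smul_cons, loc_mul_of_mem g hh hv', hhl v hv', mul_smul, hh v hv',
            hg v hv'.le, mul_inv_cancel_left]

end IsTreeAction

/-! ### Labelling the preimage tree of the cubic map -/

/-- The map `z ↦ 2 z ^ 3 - 3 z ^ 2 + 1`. -/
def cubicMap {F : Type*} [Field F] (z : F) : F := 2 * z ^ 3 - 3 * z ^ 2 + 1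

/-- The elementary symmetric functions of `E` are those of the preimages of `x` under `cubicMap`. -/
structure IsRootTriple {F : Type*} [Field F] (x : F) (E : Fin 3 → F) : Prop where
  sum : E 0 + E 1 + E 2 = 3 / 2
  pairs : E 0 * E 1 + E 0 * E 2 + E 1 * E 2 = 0
  prod : E 0 * E 1 * E 2 = (x - 1) / 2

/-- The Vandermonde determinant of three elements. -/
def vand {F : Type*} [Field F] (E : Fin 3 → F) : F := (E 0 - E 1) * (E 0 - E 2) * (E 1 - E 2)

theorem vand_comp_perm {F : Type*} [Field F] (E : Fin 3 → F) (σ : Equiv.Perm (Fin 3)) :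
    vand (E ∘ σ) = ((Equiv.Perm.sign σ : ℤˣ) : ℤ) * vand E := by
  have h : ∀ σ : Equiv.Perm (Fin 3),
      (σ 0 = 0 ∧ σ 1 = 1 ∧ σ 2 = 2 ∧ Equiv.Perm.sign σ = 1) ∨
      (σ 0 = 1 ∧ σ 1 = 0 ∧ σ 2 = 2 ∧ Equiv.Perm.sign σ = -1) ∨
      (σ 0 = 2 ∧ σ 1 = 1 ∧ σ 2 = 0 ∧ Equiv.Perm.sign σ = -1) ∨
      (σ 0 = 0 ∧ σ 1 = 2 ∧ σ 2 = 1 ∧ Equiv.Perm.sign σ = -1) ∨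
      (σ 0 = 1 ∧ σ 1 = 2 ∧ σ 2 = 0 ∧ Equiv.Perm.sign σ = 1) ∨
      (σ 0 = 2 ∧ σ 1 = 0 ∧ σ 2 = 1 ∧ Equiv.Perm.sign σ = 1) := by decide
  rcases h σ with h | h | h | h | h | h <;> obtain ⟨h0, h1, h2, h3⟩ := h <;>
    simp only [vand, Function.comp_apply, h0, h1, h2, h3, Units.val_one, Units.val_neg] <;>
    push_cast <;> ring

namespace IsRootTriple

variable {F : Type*} [Field F] [CharZero F] {x : F} {E : Fin 3 → F}

theorem sub_eq (h : IsRootTriple x E) (z : F) :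
    cubicMap z - x = 2 * ((z - E 0) * (z - E 1) * (z - E 2)) := by
  have h1 := h.sum
  have h2 := h.pairs
  have h3 := h.prod
  unfold cubicMap
  linear_combination (2 * z ^ 2) * h1 - 2 * z * h2 + 2 * h3

theorem cubicMap_eq (h : IsRootTriple x E) (a : Fin 3) : cubicMap (E a) = x := by
  rw [← sub_eq_zero, h.sub_eq]
  fin_cases a <;> simp

theorem exists_eq (h : IsRootTriple x E) {z : F} (hz : cubicMap z = x) : ∃ a, E a = z := by
  have := h.sub_eq z
  rw [hz, sub_self, eq_comm, mul_eq_zero, mul_eq_zero, mul_eq_zero] at this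
  rcases this with h | (h | h) | h
  · exact absurd h two_ne_zero
  · exact ⟨0, (sub_eq_zero.mp h).symm⟩
  · exact ⟨1, (sub_eq_zero.mp h).symm⟩
  · exact ⟨2, (sub_eq_zero.mp h).symm⟩

/-- This is the discriminant of a cubic with e1 = 3/2, e2 = 0, e3 = (x - 1)/2; the cofactor in the
final step collects the terms of the discriminant formula divisible by e2. -/
theorem vand_sq (h : IsRootTriple x E) : vand E ^ 2 = 27 / 4 * (x * (1 - x)) := by
  have h1 : E 2 = 3 / 2 - E 0 - E 1 := by linear_combination h.sum
  have h2 := h.pairs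
  have h3 : x = 1 + 2 * (E 0 * E 1 * E 2) := by linear_combination (-2) * h.prod
  unfold vand
  rw [h3]
  rw [h1] at h2 ⊢
  linear_combination (9 / 4 * (E 0 * E 1 + E 0 * (3 / 2 - E 0 - E 1) + E 1 * (3 / 2 - E 0 - E 1))
    - 4 * (E 0 * E 1 + E 0 * (3 / 2 - E 0 - E 1) + E 1 * (3 / 2 - E 0 - E 1)) ^ 2
    + 27 * (E 0 * E 1 * (3 / 2 - E 0 - E 1))) * h2

theorem vand_ne_zero (h : IsRootTriple x E) (h0 : x ≠ 0) (h1 : x ≠ 1) : vand E ≠ 0 := by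
  intro h2
  have := h.vand_sq
  rw [h2] at this
  have h3 : (27 / 4 : F) * (x * (1 - x)) ≠ 0 :=
    mul_ne_zero (by norm_num) (mul_ne_zero h0 (sub_ne_zero.mpr h1.symm))
  exact h3 (by rw [← this]; ring)

theorem injective (h : IsRootTriple x E) (h0 : x ≠ 0) (h1 : x ≠ 1) : Function.Injective E := by
  have hv := h.vand_ne_zero h0 h1
  simp only [vand, mul_ne_zero_iff, sub_ne_zero] at hv
  obtain ⟨⟨h01, h02⟩, h12⟩ := hv
  intro a b hab
  fin_cases a <;> fin_cases b <;> simp_all [eq_comm]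

theorem comp_swap (h : IsRootTriple x E) : IsRootTriple x (E ∘ Equiv.swap 0 1) := by
  have h4 : Equiv.swap (0 : Fin 3) 1 2 = 2 := by decide
  constructor <;> simp only [Function.comp_apply, Equiv.swap_apply_left, Equiv.swap_apply_right, h4]
  · linear_combination h.sum
  · linear_combination h.pairs
  · linear_combination h.prod

/-- Evaluating f - x at 0 and at 1 gives the products of the E a and of the 1 - E a; together they
are x(1 - x)/4, so the discriminants of the children multiply to a square times that of the parent.
-/
theorem prod_vand_sq (h : IsRootTriple x E) {E' : Fin 3 → Fin 3 → F}
    (h' : ∀ a, IsRootTriple (E a) (E' a)) :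
    (∏ a, vand (E' a)) ^ 2 = (27 / 8 * vand E) ^ 2 := by
  have h1 := h.sub_eq 1
  have h3 := h.prod
  rw [← Finset.prod_pow, Fin.prod_univ_three, (h' 0).vand_sq, (h' 1).vand_sq, (h' 2).vand_sq,
    mul_pow, h.vand_sq]
  have h4 : (1 - E 0) * (1 - E 1) * (1 - E 2) = - x / 2 := by
    unfold cubicMap at h1
    linear_combination (-1 / 2) * h1
  linear_combination (27 / 4) ^ 3 * (1 - E 0) * (1 - E 1) * (1 - E 2) * h3 +
    (27 / 4) ^ 3 * ((x - 1) / 2) * h4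

end IsRootTriple

theorem exists_isRootTriple {F : Type*} [Field F] [CharZero F] [IsAlgClosed F] (x : F) :
    ∃ E : Fin 3 → F, IsRootTriple x E := by
  let P : Cubic F := ⟨2, -3, 0, 1 - x⟩
  have ha : P.a ≠ 0 := two_ne_zero
  obtain ⟨r, s, t, h⟩ := (Cubic.splits_iff_roots_eq_three (φ := RingHom.id F) ha).mp
    (IsAlgClosed.splits _)
  have hb := Cubic.b_eq_three_roots ha h
  have hc := Cubic.c_eq_three_roots ha h
  have hd := Cubic.d_eq_three_roots ha h
  simp only [P, RingHom.id_apply] at hb hc hd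
  refine ⟨![r, s, t], ?_, ?_, ?_⟩ <;>
    simp only [Matrix.cons_val_zero, Matrix.cons_val_one, Matrix.cons_val]
  · linear_combination (1 / 2) * hb
  · linear_combination (-1 / 2) * hc
  · linear_combination (1 / 2) * hd

/-! ### A labelling compatible with the Vandermonde relation. -/

section Label

variable {Ω : Type*} [Field Ω] [CharZero Ω] [IsAlgClosed Ω]

/-- An enumeration of the preimages of `x`. -/
noncomputable def preimages (x : Ω) : Fin 3 → Ω := (exists_isRootTriple x).choose

theorem isRootTriple_preimages (x : Ω) : IsRootTriple x (preimages x) :=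
  (exists_isRootTriple x).choose_spec

open Classical in
/-- The labelling of the preimage tree of `x` by words, in which the Vandermonde determinants at
siblings and at their parent are compatible. -/
noncomputable def label (x : Ω) : List (Fin 3) → Fin 3 → Ω
  | [] => preimages x
  | a :: v =>
    -- Reordering one of the three child triples by a transposition corrects a wrong sign; child 0
    -- is an arbitrary choice.
    if a = 0 ∧ ∏ b, vand (preimages (label x v b)) ≠ 27 / 8 * vand (label x v) then
      preimages (label x v 0) ∘ Equiv.swap 0 1
    else preimages (label x v a)

/-- The vertex of the preimage tree of `x` with a given label. -/
noncomputable def node (x : Ω) : List (Fin 3) → Ω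
  | [] => x
  | a :: v => label x v a

theorem isRootTriple_label (x : Ω) (v : List (Fin 3)) : IsRootTriple (node x v) (label x v) := by
  match v with
  | [] => exact isRootTriple_preimages x
  | a :: v =>
    rw [label, node]
    split_ifs with h
    · rw [h.1]; exact (isRootTriple_preimages _).comp_swap
    · exact isRootTriple_preimages _

theorem prod_vand_label (x : Ω) (v : List (Fin 3)) :
    ∏ a, vand (label x (a :: v)) = 27 / 8 * vand (label x v) := by
  by_cases h : ∏ b, vand (preimages (label x v b)) = 27 / 8 * vand (label x v)
  · rw [← h]
    refine Finset.prod_congr rfl fun a _ => ?_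
    rw [label, if_neg (by simp [h])]
  · have h2 := (sq_eq_sq_iff_eq_or_eq_neg.mp ((isRootTriple_label x v).prod_vand_sq
      fun a => isRootTriple_preimages (label x v a))).resolve_left h
    rw [Fin.prod_univ_three] at h2 ⊢
    rw [label, label, label, if_pos ⟨rfl, h⟩, if_neg (by simp), if_neg (by simp), vand_comp_perm,
      Equiv.Perm.sign_swap (by decide)]
    push_cast
    linear_combination -h2

theorem node_ne {x : Ω} (h0 : x ≠ 0) (h1 : x ≠ 1) (v : List (Fin 3)) :
    node x v ≠ 0 ∧ node x v ≠ 1 := by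
  induction v with
  | nil => exact ⟨h0, h1⟩
  | cons a v ih =>
    have h : cubicMap (node x (a :: v)) = node x v := (isRootTriple_label x v).cubicMap_eq a
    refine ⟨fun h2 => ih.2 ?_, fun h2 => ih.1 ?_⟩ <;> rw [← h, h2, cubicMap] <;> norm_num

theorem vand_label_ne_zero {x : Ω} (h0 : x ≠ 0) (h1 : x ≠ 1) (v : List (Fin 3)) :
    vand (label x v) ≠ 0 :=
  (isRootTriple_label x v).vand_ne_zero (node_ne h0 h1 v).1 (node_ne h0 h1 v).2

theorem cubicMap_node (x : Ω) (a : Fin 3) (v : List (Fin 3)) :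
    cubicMap (node x (a :: v)) = node x v := (isRootTriple_label x v).cubicMap_eq a

theorem iterate_cubicMap_node (x : Ω) (v : List (Fin 3)) : cubicMap^[v.length] (node x v) = x := by
  induction v with
  | nil => rfl
  | cons a v ih => rw [List.length_cons, Function.iterate_succ_apply, cubicMap_node, ih]

theorem exists_node_eq {x z : Ω} {n : ℕ} (h : cubicMap^[n] z = x) :
    ∃ v : List (Fin 3), v.length = n ∧ node x v = z := by
  induction n generalizing z with
  | zero => exact ⟨[], rfl, h.symm⟩
  | succ n ih =>
    obtain ⟨v, hv, hz⟩ := ih (z := cubicMap z) (by rw [← h, Function.iterate_succ_apply])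
    obtain ⟨a, ha⟩ := (isRootTriple_label x v).exists_eq hz.symm
    exact ⟨a :: v, by simp [hv], ha⟩

theorem eq_of_node_eq {x : Ω} (h0 : x ≠ 0) (h1 : x ≠ 1) {v w : List (Fin 3)}
    (hl : v.length = w.length) (h : node x v = node x w) : v = w := by
  induction v generalizing w with
  | nil => exact (List.length_eq_zero_iff.mp hl.symm).symm
  | cons a v ih =>
    match w, hl with
    | b :: w, hl =>
      have hvw : v = w := ih (by simpa using hl) (by rw [← cubicMap_node x a v, h, cubicMap_node])
      subst hvw
      rw [(isRootTriple_label x v).injective (node_ne h0 h1 v).1 (node_ne h0 h1 v).2 h]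

end Label

/-! ### The Galois action on labels and the sign relation. -/

section Galois

variable {K Ω : Type*} [Field K] [Field Ω] [Algebra K Ω]

theorem map_cubicMap (g : Ω ≃ₐ[K] Ω) (z : Ω) : g (cubicMap z) = cubicMap (g z) := by
  simp [cubicMap, map_ofNat g]

theorem map_iterate_cubicMap (g : Ω ≃ₐ[K] Ω) (n : ℕ) (z : Ω) :
    g (cubicMap^[n] z) = cubicMap^[n] (g z) :=
  (Function.Semiconj.iterate_right (f := g) (map_cubicMap g) n) z

variable [CharZero Ω] [IsAlgClosed Ω]

/-- The Galois group acts on the labels of the preimage tree of an element of the base field. -/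
theorem exists_treeAction {α : K} (h0 : algebraMap K Ω α ≠ 0) (h1 : algebraMap K Ω α ≠ 1) :
    ∃ (_ : MulAction (Ω ≃ₐ[K] Ω) (List (Fin 3))), IsTreeAction (Ω ≃ₐ[K] Ω) ∧
      ∀ (g : Ω ≃ₐ[K] Ω) (v : List (Fin 3)),
        node (algebraMap K Ω α) (g • v) = g (node (algebraMap K Ω α) v) := by
  have hex : ∀ (g : Ω ≃ₐ[K] Ω) (v : List (Fin 3)), ∃ w : List (Fin 3), w.length = v.length ∧
      node (algebraMap K Ω α) w = g (node (algebraMap K Ω α) v) := fun g v =>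
    exists_node_eq (by rw [← map_iterate_cubicMap, iterate_cubicMap_node, AlgEquiv.commutes])
  choose act hlen hnode using hex
  let _ : MulAction (Ω ≃ₐ[K] Ω) (List (Fin 3)) :=
    { smul := act
      one_smul := fun v => eq_of_node_eq h0 h1 (hlen _ _) (hnode _ _)
      mul_smul := fun g h v => by
        change act (g * h) v = act g (act h v)
        refine eq_of_node_eq h0 h1 ?_ ?_
        · rw [hlen, hlen, hlen]
        · rw [hnode, hnode, hnode]; rfl }
  refine ⟨inferInstance, ⟨hlen, ?_⟩, hnode⟩
  · intro g v
    change (act g v).tail = act g v.tail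
    refine eq_of_node_eq h0 h1 (by simp [hlen]) ?_
    match v with
    | [] =>
      rw [List.tail_nil, hnode, List.length_eq_zero_iff.mp (hlen g [])]
      exact (AlgEquiv.commutes _ _).symm
    | a :: v =>
      have h2 := hnode g (a :: v)
      have h3 := hlen g (a :: v)
      cases h4 : act g (a :: v) with
      | nil => rw [h4] at h3; simp at h3
      | cons b w =>
        rw [h4] at h2
        rw [List.tail_cons, List.tail_cons, hnode, ← cubicMap_node _ b w, h2, ← map_cubicMap,
          cubicMap_node]

variable [MulAction (Ω ≃ₐ[K] Ω) (List (Fin 3))] [IsTreeAction (Ω ≃ₐ[K] Ω)]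

open IsTreeAction

variable {x : Ω} (hx : ∀ (g : Ω ≃ₐ[K] Ω) (v : List (Fin 3)), node x (g • v) = g (node x v))
include hx

theorem map_vand_label (g : Ω ≃ₐ[K] Ω) (v : List (Fin 3)) :
    g (vand (label x v)) = ((sgn g v : ℤˣ) : ℤ) * vand (label x (g • v)) := by
  have h : ∀ a, g (label x v a) = label x (g • v) (loc g v a) := fun a => by
    have := hx g (a :: v)
    rw [smul_cons] at this
    exact this.symm
  rw [sgn, ← vand_comp_perm]
  simp only [vand, map_mul, map_sub, h, Function.comp_apply]

/-- Apply g to `prod_vand_label`; the same relation holds at `g • v`, and the nonzero Vandermonde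
determinant there cancels. -/
theorem prod_sgn_galois (h0 : x ≠ 0) (h1 : x ≠ 1) (g : Ω ≃ₐ[K] Ω) (v : List (Fin 3)) :
    ∏ a, sgn g (a :: v) = sgn g v := by
  have h2 := congrArg g (prod_vand_label x v)
  rw [map_prod, map_mul, map_vand_label hx] at h2
  simp only [map_vand_label hx, smul_cons, Finset.prod_mul_distrib] at h2
  rw [Equiv.prod_comp (loc g v) (fun a => vand (label x (a :: g • v))), prod_vand_label] at h2
  have h3 : g (27 / 8) = 27 / 8 := by rw [map_div₀, map_ofNat g, map_ofNat g]
  rw [h3, mul_left_comm (27 / 8 : Ω)] at h2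
  have h5 := mul_right_cancel₀ (mul_ne_zero (by norm_num) (vand_label_ne_zero h0 h1 _)) h2
  have h6 : ((∏ a, ((sgn g (a :: v) : ℤˣ) : ℤ) : ℤ) : Ω) = (((sgn g v : ℤˣ) : ℤ) : Ω) := by
    rw [← h5]; push_cast; rfl
  apply Units.ext
  rw [Units.coe_prod]
  exact_mod_cast h6

end Galois

/-! ### Ramification along a path -/

open scoped IntermediateField

section Valuation

variable {K Ω Γ₀ : Type*} [Field K] [Field Ω] [Algebra K Ω] [LinearOrderedCommGroupWithZero Γ₀]
  (w : Valuation Ω Γ₀)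

/-- Two terms of an algebraic relation have the same valuation. -/
theorem Valuation.exists_pow_eq_of_aeval_eq_zero {L : IntermediateField K Ω} {y : Ω} (hy : y ≠ 0)
    {P : L[X]} (hP : P ≠ 0) (h : aeval y P = 0) :
    ∃ d c, 1 ≤ d ∧ d ≤ P.natDegree ∧ c ∈ L ∧ w y ^ d = w c := by
  classical
  rw [aeval_eq_sum_range] at h
  have hne : P.support.Nonempty := by rwa [Finset.nonempty_iff_ne_empty, Ne, support_eq_empty]
  obtain ⟨j, hj, hmax⟩ := P.support.exists_max_image (fun i => w (P.coeff i • y ^ i)) hne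
  have hcy : ∀ i ∈ P.support, w (P.coeff i • y ^ i) = w (P.coeff i : Ω) * w y ^ i := fun i _ => by
    rw [Algebra.smul_def, map_mul, map_pow]; rfl
  have hc0 : ∀ i ∈ P.support, (P.coeff i : Ω) ≠ 0 := fun i hi => by
    simpa using mem_support_iff.mp hi
  have hy0 : w y ≠ 0 := w.ne_zero_iff.mpr hy
  obtain ⟨i, hi, hij, heq⟩ : ∃ i ∈ P.support, i ≠ j ∧
      w (P.coeff i • y ^ i) = w (P.coeff j • y ^ j) := by
    -- A unique term of maximal value would give the whole sum that nonzero value.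
    by_contra! hcon
    have h2 : w (∑ i ∈ Finset.range (P.natDegree + 1), P.coeff i • y ^ i) =
        w (P.coeff j • y ^ j) := by
      refine w.map_sum_eq_of_lt (Finset.mem_range_succ_iff.mpr (le_natDegree_of_mem_supp j hj)) ?_
      intro i hi
      rw [Finset.mem_sdiff, Finset.mem_singleton] at hi
      by_cases his : i ∈ P.support
      · exact lt_of_le_of_ne (hmax i his) (hcon i his hi.2)
      · rw [notMem_support_iff.mp his, zero_smul, map_zero, hcy j hj]
        exact zero_lt_iff.mpr (mul_ne_zero (w.ne_zero_iff.mpr (hc0 j hj)) (pow_ne_zero _ hy0))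
    rw [h, map_zero, hcy j hj] at h2
    exact mul_ne_zero (w.ne_zero_iff.mpr (hc0 j hj)) (pow_ne_zero _ hy0) h2.symm
  rw [hcy i hi, hcy j hj] at heq
  have key : ∀ i ∈ P.support, ∀ j ∈ P.support, i < j →
      w (P.coeff i : Ω) * w y ^ i = w (P.coeff j : Ω) * w y ^ j →
      ∃ d c, 1 ≤ d ∧ d ≤ P.natDegree ∧ c ∈ L ∧ w y ^ d = w c := by
    intro i hi j hj hlt heq
    refine ⟨j - i, P.coeff i / P.coeff j, by omega,
      (Nat.sub_le _ _).trans (le_natDegree_of_mem_supp j hj),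
      div_mem (SetLike.coe_mem _) (SetLike.coe_mem _), ?_⟩
    rw [map_div₀, eq_div_iff (w.ne_zero_iff.mpr (hc0 j hj))]
    refine mul_right_cancel₀ (pow_ne_zero i hy0) ?_
    rw [heq, mul_right_comm, ← pow_add, Nat.sub_add_cancel hlt.le, mul_comm]
  rcases lt_or_gt_of_ne hij with hlt | hlt
  · exact key i hi j hj hlt heq
  · exact key j hj i hi hlt heq.symm

/-- A non-square value does not become a fourth power in a cubic extension. -/
theorem Valuation.pow_four_ne_of_sq_ne {L : IntermediateField K Ω} {b y : Ω} (hb : b ∈ L)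
    (hb0 : b ≠ 0) (h : ∀ c ∈ L, w c ^ 2 ≠ w b) {P : L[X]} (hP : P ≠ 0) (hdeg : P.natDegree ≤ 3)
    (hy : aeval y P = 0) : w y ^ 4 ≠ w b := by
  intro h4
  have hy0 : y ≠ 0 := by
    rintro rfl
    rw [map_zero, zero_pow four_ne_zero] at h4
    exact hb0 (w.zero_iff.mp h4.symm)
  obtain ⟨d, c, hd1, hd3, hc, hdc⟩ := w.exists_pow_eq_of_aeval_eq_zero hy0 hP hy
  have hone : ∀ c ∈ L, w y ≠ w c := fun c hc hyc =>
    h (c ^ 2) (pow_mem hc 2) (by rw [← h4, hyc, map_pow, ← pow_mul])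
  have hd : d = 1 ∨ d = 2 ∨ d = 3 := by omega
  rcases hd with rfl | rfl | rfl
  · exact hone c hc (by rw [← hdc, pow_one])
  · exact h c hc (by rw [← hdc, ← pow_mul, ← h4])
  -- With w(y)^4 = w(b) and w(y)^3 = w(c), the value of y itself comes from L, which is the case d =
  -- 1.
  · refine hone (b / c) (div_mem hb hc) ?_
    have hy0' : w y ≠ 0 := w.ne_zero_iff.mpr hy0
    rw [map_div₀, ← hdc, ← h4, eq_div_iff (pow_ne_zero 3 hy0'), ← pow_succ']

theorem exists_cubic_aeval_eq_zero {L : IntermediateField K Ω} [CharZero Ω] {b z y : Ω}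
    (hb : b ∈ L) (hz : cubicMap z = b) (hy : y ∈ K⟮z⟯) :
    ∃ P : L[X], P ≠ 0 ∧ P.natDegree ≤ 3 ∧ aeval y P = 0 := by
  have : CharZero L := ⟨fun m n h => by
    have := congrArg (algebraMap L Ω) h
    simpa using this⟩
  let C3 : Cubic L := ⟨2, -3, 0, 1 - ⟨b, hb⟩⟩
  have hdeg : C3.toPoly.natDegree = 3 := Cubic.natDegree_of_a_ne_zero (two_ne_zero : C3.a ≠ 0)
  have h0 : C3.toPoly ≠ 0 := fun h => by rw [h] at hdeg; simp at hdeg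
  have hroot : aeval z C3.toPoly = 0 := by
    have h1 : algebraMap L Ω ⟨b, hb⟩ = b := rfl
    simp only [Cubic.toPoly, C3, map_add, map_mul, aeval_C, aeval_X_pow, aeval_X, map_sub, map_one,
      map_neg, map_zero, h1, map_ofNat]
    rw [← hz, cubicMap]; ring
  have hint : IsIntegral L z := IsAlgebraic.isIntegral ⟨_, h0, hroot⟩
  have : FiniteDimensional L L⟮z⟯ := IntermediateField.adjoin.finiteDimensional hint
  have hyz : y ∈ L⟮z⟯ := by
    have h1 : K⟮z⟯ ≤ (L⟮z⟯).restrictScalars K := by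
      rw [IntermediateField.adjoin_le_iff, Set.singleton_subset_iff]
      exact IntermediateField.mem_adjoin_simple_self L z
    exact h1 hy
  refine ⟨minpoly L (⟨y, hyz⟩ : L⟮z⟯), minpoly.ne_zero (Algebra.IsIntegral.isIntegral _), ?_, ?_⟩
  · have : Module.Free L L⟮z⟯ := Module.Free.of_divisionRing L L⟮z⟯
    refine (minpoly.natDegree_le (⟨y, hyz⟩ : L⟮z⟯)).trans ?_
    rw [IntermediateField.adjoin.finrank hint, ← hdeg]
    exact natDegree_le_natDegree (minpoly.degree_le_of_ne_zero L z h0 hroot)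
  · have := congrArg (algebraMap L⟮z⟯ Ω) (minpoly.aeval L (⟨y, hyz⟩ : L⟮z⟯))
    rwa [← aeval_algebraMap_apply, map_zero] at this

variable {w} in
theorem Valuation.map_eq_one_of_one_sub_lt {x : Ω} (h : w (1 - x) < 1) : w x = 1 := by
  have := w.map_one_sub_of_lt h
  rwa [sub_sub_cancel] at this

variable {w} in
theorem Valuation.map_three_of_two_lt (h2 : w 2 < 1) : w 3 = 1 := by
  have := w.map_one_add_of_lt h2
  norm_num at this
  exact this

/-- The symmetry f(1 - z) = 1 - f(z) exchanges the cases of x near 0 and near 1. -/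
theorem IsRootTriple.one_sub {x : Ω} {E : Fin 3 → Ω} [CharZero Ω] (h : IsRootTriple x E) :
    IsRootTriple (1 - x) (fun a => 1 - E a) := by
  have h1 := h.sum
  have h2 := h.pairs
  have h3 := h.prod
  constructor
  · linear_combination -h1
  · linear_combination -2 * h1 + h2
  · linear_combination -h1 + h2 - h3

/-- Here x = (z - 1)^2 (2z + 1) at each preimage z. The pairwise products of the 2z + 1 sum to 9, a
unit, so some 2z + 1 has value at least 1. Then z is near 1, 2z + 1 is a unit, and w(1 - z)^2 =
w(x). -/
theorem IsRootTriple.exists_ramified_of_lt [CharZero Ω] (h2 : w 2 < 1) {x : Ω} {E : Fin 3 → Ω}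
    (h : IsRootTriple x E) (hx : w x < 1) :
    ∃ a, w (1 - E a) < 1 ∧ w (E a * (1 - E a)) ^ 2 = w (x * (1 - x)) := by
  have hsum : (2 * E 0 + 1) * (2 * E 1 + 1) + (2 * E 0 + 1) * (2 * E 2 + 1) +
      (2 * E 1 + 1) * (2 * E 2 + 1) = 3 ^ 2 := by
    linear_combination 4 * h.sum + 4 * h.pairs
  have h3 : w 3 = 1 := Valuation.map_three_of_two_lt h2
  obtain ⟨a, ha⟩ : ∃ a, 1 ≤ w (2 * E a + 1) := by
    by_contra! hcon
    have hlt := congrArg w hsum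
    rw [map_pow, h3, one_pow] at hlt
    refine absurd hlt (ne_of_lt (w.map_add_lt (w.map_add_lt ?_ ?_) ?_)) <;> rw [map_mul] <;>
      exact mul_lt_one' (hcon _) (hcon _)
  have heq : (E a - 1) ^ 2 * (2 * E a + 1) = x := by
    rw [← h.cubicMap_eq a, cubicMap]; ring
  have hwx := congrArg w heq
  rw [map_mul, map_pow] at hwx
  have ht : w (1 - E a) < 1 := by
    rw [w.map_sub_swap]
    by_contra! hge
    exact absurd hx (not_lt.mpr (hwx ▸ one_le_mul (one_le_pow₀ hge) ha))
  refine ⟨a, ht, ?_⟩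
  have hu : w (2 * E a + 1) = 1 := by
    rw [add_comm]
    refine w.map_one_add_of_lt ?_
    rw [map_mul, Valuation.map_eq_one_of_one_sub_lt ht, mul_one]
    exact h2
  rw [map_mul, Valuation.map_eq_one_of_one_sub_lt ht, one_mul, map_mul, w.map_one_sub_of_lt hx,
    mul_one, ← hwx, hu, mul_one, w.map_sub_swap]

theorem IsRootTriple.exists_ramified [CharZero Ω] (h2 : w 2 < 1) {x : Ω} {E : Fin 3 → Ω}
    (h : IsRootTriple x E) (hx : w x < 1 ∨ w (1 - x) < 1) :
    ∃ a, (w (E a) < 1 ∨ w (1 - E a) < 1) ∧ w (E a * (1 - E a)) ^ 2 = w (x * (1 - x)) := by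
  rcases hx with hx | hx
  · obtain ⟨a, h1, h2⟩ := h.exists_ramified_of_lt w h2 hx
    exact ⟨a, Or.inr h1, h2⟩
  · obtain ⟨a, h1, h2⟩ := h.one_sub.exists_ramified_of_lt w h2 hx
    rw [sub_sub_cancel] at h1
    refine ⟨a, Or.inl h1, ?_⟩
    rw [mul_comm, mul_comm x]
    simpa using h2

open IsTreeAction in
/-- A path in the preimage tree along which the extension of degree two ramifies. -/
theorem exists_ramified_path [CharZero Ω] [IsAlgClosed Ω] (h2 : w 2 < 1) {x : Ω}
    (hx : w x < 1 ∨ w (1 - x) < 1) : ∃ v : ℕ → List (Fin 3), IsPath v ∧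
      ∀ j, w (node x (v (j + 1)) * (1 - node x (v (j + 1)))) ^ 2 =
        w (node x (v j) * (1 - node x (v j))) := by
  have hstep : ∀ u : {u : List (Fin 3) // w (node x u) < 1 ∨ w (1 - node x u) < 1}, ∃ a,
      (w (node x (a :: u.1)) < 1 ∨ w (1 - node x (a :: u.1)) < 1) ∧
      w (node x (a :: u.1) * (1 - node x (a :: u.1))) ^ 2 =
        w (node x u.1 * (1 - node x u.1)) :=
    fun u => (isRootTriple_label x u.1).exists_ramified w h2 u.2
  choose a ha1 ha2 using hstep
  let p : ℕ → {u : List (Fin 3) // w (node x u) < 1 ∨ w (1 - node x u) < 1} := fun j =>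
    Nat.rec ⟨[], hx⟩ (fun _ u => ⟨a u :: u.1, ha1 u⟩) j
  exact ⟨fun j => (p j).1, ⟨rfl, fun j => ⟨a (p j), rfl⟩⟩, fun j => ha2 (p j)⟩

open IsTreeAction in
theorem sq_ne_of_ramified_path [CharZero Ω] [IsAlgClosed Ω] {α : K}
    (h0 : algebraMap K Ω α ≠ 0) (h1 : algebraMap K Ω α ≠ 1) {v : ℕ → List (Fin 3)}
    (hv : IsPath v) (hw : ∀ j, w (node (algebraMap K Ω α) (v (j + 1)) *
      (1 - node (algebraMap K Ω α) (v (j + 1)))) ^ 2 =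
        w (node (algebraMap K Ω α) (v j) * (1 - node (algebraMap K Ω α) (v j))))
    (hα : ∀ c : K, w (algebraMap K Ω c) ^ 2 ≠ w (algebraMap K Ω α * (1 - algebraMap K Ω α)))
    (j : ℕ) : ∀ y ∈ K⟮node (algebraMap K Ω α) (v j)⟯,
      w y ^ 2 ≠ w (node (algebraMap K Ω α) (v j) * (1 - node (algebraMap K Ω α) (v j))) := by
  induction j with
  | zero =>
    rw [hv.1]
    intro y hy
    have : (K⟮node (algebraMap K Ω α) []⟯ : IntermediateField K Ω) = ⊥ := by
      rw [IntermediateField.adjoin_simple_eq_bot_iff]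
      exact IntermediateField.algebraMap_mem _ α
    rw [this, IntermediateField.mem_bot] at hy
    obtain ⟨c, rfl⟩ := hy
    exact hα c
  | succ j ih =>
    intro y hy h
    obtain ⟨a, ha⟩ := hv.2 j
    have hmem := IntermediateField.mem_adjoin_simple_self K (node (algebraMap K Ω α) (v j))
    obtain ⟨P, hP, hdeg, hPy⟩ := exists_cubic_aeval_eq_zero hmem
      (by rw [ha, cubicMap_node]) hy
    have hne := node_ne h0 h1 (v j)
    refine w.pow_four_ne_of_sq_ne (mul_mem hmem (sub_mem (one_mem _) hmem))
      (mul_ne_zero hne.1 (sub_ne_zero.mpr hne.2.symm)) ih hP hdeg hPy ?_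
    rw [← hw, ← h, ← pow_mul]

end Valuation

/-! ### Independence of the signs along the ramified path. -/

/-- Independent characters of order two can be separated. -/
theorem Subgroup.exists_eq_neg_one_of_independent {G : Type*} [Group G] (S : Subgroup G)
    {χ : ℕ → G → ℤˣ} {k : ℕ} (hχ : ∀ j < k, ∀ g ∈ S, ∀ h ∈ S, χ j (g * h) = χ j g * χ j h)
    {ψ : G → ℤˣ} (hψ : ∀ g ∈ S, ∀ h ∈ S, ψ (g * h) = ψ g * ψ h)
    (H : ∀ T ⊆ Finset.range k, ∃ g ∈ S, ψ g * ∏ j ∈ T, χ j g = -1) :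
    ∃ g ∈ S, (∀ j < k, χ j g = 1) ∧ ψ g = -1 := by
  induction k generalizing ψ with
  | zero =>
    obtain ⟨g, hg, h⟩ := H ∅ (Finset.empty_subset _)
    exact ⟨g, hg, fun j hj => absurd hj (Nat.not_lt_zero j), by simpa using h⟩
  | succ k ih =>
    have hχ' : ∀ j < k, ∀ g ∈ S, ∀ h ∈ S, χ j (g * h) = χ j g * χ j h :=
      fun j hj => hχ j (hj.trans (Nat.lt_succ_self k))
    have hk := hχ k (Nat.lt_succ_self k)
    have hlt : ∀ {p : G}, (∀ j < k, χ j p = 1) → χ k p = 1 → ∀ j < k + 1, χ j p = 1 := by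
      intro p h1 h2 j hj
      rcases (Nat.lt_succ_iff.mp hj).lt_or_eq with h | rfl
      exacts [h1 j h, h2]
    obtain ⟨g, hg, hg1, hg2⟩ := ih hχ' hψ fun T hT =>
      H T (hT.trans (Finset.range_mono (Nat.le_succ k)))
    obtain ⟨h, hh, hh1, hh2⟩ := ih (ψ := fun g => ψ g * χ k g) hχ'
      (fun g hg h hh => by rw [hψ g hg h hh, hk g hg h hh, mul_mul_mul_comm]) fun T hT => by
        obtain ⟨g, hg, h⟩ := H (insert k T) (by
          intro i hi
          rcases Finset.mem_insert.mp hi with rfl | hi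
          · simp
          · exact Finset.range_mono (Nat.le_succ k) (hT hi))
        refine ⟨g, hg, ?_⟩
        rwa [Finset.prod_insert (fun hk => by simpa using hT hk), ← mul_assoc] at h
    -- The induction applied to ψ and to ψ χ_k gives g and h. If both are odd under χ_k, then ψ is
    -- -1 on g and 1 on h, so gh works.
    rcases Int.units_eq_one_or (χ k g) with h1 | h1
    · exact ⟨g, hg, hlt hg1 h1, hg2⟩
    rcases Int.units_eq_one_or (χ k h) with h3 | h3
    · exact ⟨h, hh, hlt hh1 h3, by simpa [h3] using hh2⟩
    have h4 : ψ h = 1 := by simpa [h3] using hh2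
    refine ⟨g * h, mul_mem hg hh, hlt (fun j hj => ?_) ?_, ?_⟩
    · rw [hχ' j hj g hg h hh, hg1 j hj, hh1 j hj, one_mul]
    · rw [hk g hg h hh, h1, h3]; rfl
    · rw [hψ g hg h hh, hg2, h4, mul_one]

section Independence

open IsTreeAction

variable {K Ω Γ₀ : Type*} [Field K] [Field Ω] [CharZero Ω] [IsAlgClosed Ω] [Algebra K Ω]
  [IsGalois K Ω] [LinearOrderedCommGroupWithZero Γ₀] (w : Valuation Ω Γ₀)
  [MulAction (Ω ≃ₐ[K] Ω) (List (Fin 3))] [IsTreeAction (Ω ≃ₐ[K] Ω)]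

/-- Nodes on one level are distinct, so fixing the node is the same as fixing its label; the Galois
correspondence applies. -/
theorem mem_adjoin_node {α : K} (h0 : algebraMap K Ω α ≠ 0) (h1 : algebraMap K Ω α ≠ 1)
    (hnode : ∀ (g : Ω ≃ₐ[K] Ω) (v : List (Fin 3)),
        node (algebraMap K Ω α) (g • v) = g (node (algebraMap K Ω α) v))
    {u : List (Fin 3)} {y : Ω} (hy : ∀ g : Ω ≃ₐ[K] Ω, g • u = u → g y = y) :
    y ∈ K⟮node (algebraMap K Ω α) u⟯ := by
  rw [← InfiniteGalois.fixedField_fixingSubgroup K⟮node (algebraMap K Ω α) u⟯,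
    IntermediateField.mem_fixedField_iff]
  intro g hg
  refine hy g (eq_of_node_eq h0 h1 (smul_length g u) ?_)
  rw [hnode]
  exact (IntermediateField.mem_fixingSubgroup_iff _ _).mp hg _
    (IntermediateField.mem_adjoin_simple_self K _)

theorem exists_sgn_neg_of_ramified_path (h2 : w 2 < 1) {α : K}
    (h0 : algebraMap K Ω α ≠ 0) (h1 : algebraMap K Ω α ≠ 1)
    (hnode : ∀ (g : Ω ≃ₐ[K] Ω) (v : List (Fin 3)),
        node (algebraMap K Ω α) (g • v) = g (node (algebraMap K Ω α) v))
    {v : ℕ → List (Fin 3)} (hv : IsPath v)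
    (hw : ∀ j, w (node (algebraMap K Ω α) (v (j + 1)) *
      (1 - node (algebraMap K Ω α) (v (j + 1)))) ^ 2 =
        w (node (algebraMap K Ω α) (v j) * (1 - node (algebraMap K Ω α) (v j))))
    (hα : ∀ c : K, w (algebraMap K Ω c) ^ 2 ≠ w (algebraMap K Ω α * (1 - algebraMap K Ω α)))
    (m : ℕ) : ∃ g : Ω ≃ₐ[K] Ω, g • v m = v m ∧ (∀ j < m, sgn g (v j) = 1) ∧ sgn g (v m) = -1 := by
  set x := algebraMap K Ω α with hx
  refine (MulAction.stabilizer (Ω ≃ₐ[K] Ω) (v m)).exists_eq_neg_one_of_independent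
    (χ := fun j g => sgn g (v j)) (ψ := fun g => sgn g (v m))
    (fun j hj g _ h hh => hv.sgn_mul hj.le g hh) (fun g _ h hh => hv.sgn_mul le_rfl g hh) ?_
  intro T hT
  by_contra! hcon
  have hT' : ∀ j ∈ T, j < m := fun j hj => Finset.mem_range.mp (hT hj)
  -- The factors 2 clear the denominator of 27/4, since 2 is not a unit at p whereas 3 is.
  let y : Ω := 2 * vand (label x (v m)) * ∏ j ∈ T, (2 * vand (label x (v j)))
  have hmap : ∀ g : Ω ≃ₐ[K] Ω, ∀ j ≤ m, g • v m = v m →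
      g (2 * vand (label x (v j))) = ((sgn g (v j) : ℤˣ) : ℤ) * (2 * vand (label x (v j))) := by
    intro g j hj hg
    rw [map_mul, map_vand_label hnode, hv.smul_eq_of_le hj hg, map_ofNat g]; ring
  have hy : y ∈ K⟮node x (v m)⟯ := by
    refine mem_adjoin_node h0 h1 hnode fun g hg => ?_
    have hs := (Int.units_eq_one_or _).resolve_right (hcon g hg)
    have hs' := congrArg (fun e : ℤˣ => (((e : ℤˣ) : ℤ) : Ω)) hs
    simp only [Units.val_mul, Units.coe_prod, Units.val_one] at hs'
    push_cast at hs'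
    simp only [y]
    rw [map_mul, map_prod, hmap g m le_rfl hg, Finset.prod_congr rfl
      fun j hj => hmap g j (hT' j hj).le hg, Finset.prod_mul_distrib, mul_mul_mul_comm, hs',
      one_mul]
  have hnodemem : ∀ j ≤ m, node x (v j) ∈ K⟮node x (v m)⟯ := fun j hj =>
    mem_adjoin_node h0 h1 hnode fun g hg => by rw [← hnode, hv.smul_eq_of_le hj hg]
  have hsq : ∀ j, w (2 * vand (label x (v j))) ^ 2 = w (node x (v j) * (1 - node x (v j))) := by
    intro j
    have : (2 * vand (label x (v j))) ^ 2 = 3 ^ 3 * (node x (v j) * (1 - node x (v j))) := by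
      rw [mul_pow, (isRootTriple_label x (v j)).vand_sq]; ring
    rw [← map_pow, this, map_mul, map_pow, Valuation.map_three_of_two_lt h2, one_pow, one_mul]
  -- The shift to j + 1 makes w(c) the value of the product over T in y, while j + 1 ≤ m keeps c in
  -- the field of `v m`. So w(y / c)^2 would be the forbidden value.
  let c : Ω := ∏ j ∈ T, (node x (v (j + 1)) * (1 - node x (v (j + 1))))
  have hc : c ∈ K⟮node x (v m)⟯ := prod_mem fun j hj =>
    mul_mem (hnodemem _ (hT' j hj)) (sub_mem (one_mem _) (hnodemem _ (hT' j hj)))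
  have hc0 : w c ≠ 0 := w.ne_zero_iff.mpr (Finset.prod_ne_zero_iff.mpr fun j _ =>
    mul_ne_zero (node_ne h0 h1 _).1 (sub_ne_zero.mpr (node_ne h0 h1 _).2.symm))
  refine sq_ne_of_ramified_path w h0 h1 hv hw hα m (y / c) (div_mem hy hc) ?_
  rw [map_div₀, div_pow, div_eq_iff (pow_ne_zero 2 hc0)]
  simp only [y, c, map_mul w, map_prod]
  rw [← map_mul, mul_pow, ← Finset.prod_pow, ← Finset.prod_pow, ← map_mul, hsq]
  congr 1
  refine Finset.prod_congr rfl fun j _ => ?_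
  rw [← map_mul, ← map_mul, hsq, hw]

end Independence

/-! ### The Eisenstein criterion for the iterates -/

section Eisenstein

/-- The polynomial `2 z ^ 3 - 3 z ^ 2 + 1` over a commutative ring. -/
noncomputable def cubicPolynomial (R : Type*) [CommRing R] : R[X] := 2 * X ^ 3 - 3 * X ^ 2 + 1

theorem map_iterate_comp_cubicPolynomial {R S : Type*} [CommRing R] [CommRing S] (φ : R →+* S)
    (n : ℕ) : ((cubicPolynomial R).comp^[n] X).map φ = (cubicPolynomial S).comp^[n] X := by
  induction n with
  | zero => simp
  | succ n ih =>
    rw [Function.iterate_succ_apply', Function.iterate_succ_apply', Polynomial.map_comp, ih]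
    simp [cubicPolynomial]

theorem iterate_comp_cubicPolynomial_of_charP {k : Type*} [Field k] [CharP k 3] (n : ℕ) :
    ∃ a u : k, u ≠ 0 ∧ (cubicPolynomial k).comp^[n] X = C a + C u * X ^ 3 ^ n := by
  have h3 : (3 : k[X]) = 0 := by
    have : ((3 : ℕ) : k[X]) = 0 := CharP.cast_eq_zero _ 3
    exact_mod_cast this
  have : ExpChar k[X] 3 := ExpChar.prime Nat.prime_three
  induction n with
  | zero => exact ⟨0, 1, one_ne_zero, by simp⟩
  | succ n ih =>
    obtain ⟨a, u, hu, h⟩ := ih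
    refine ⟨1 - a ^ 3, - u ^ 3, neg_ne_zero.mpr (pow_ne_zero 3 hu), ?_⟩
    have h1 : (cubicPolynomial k).comp (C a + C u * X ^ 3 ^ n) =
        2 * (C a + C u * X ^ 3 ^ n) ^ 3 - 3 * (C a + C u * X ^ 3 ^ n) ^ 2 + 1 := by
      simp [cubicPolynomial]
    rw [Function.iterate_succ_apply', h, h1, add_pow_expChar, mul_pow, ← pow_mul, ← pow_succ]
    simp only [map_sub, map_neg, map_pow, map_one]
    linear_combination (C a ^ 3 + C u ^ 3 * X ^ 3 ^ (n + 1) -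
      (C a + C u * X ^ 3 ^ n) ^ 2) * h3

theorem exists_iterate_eval_eq (R : Type*) [CommRing R] (n : ℕ) {e : R} (he : e = 0 ∨ e = 1) :
    ∃ c : R, (c = 0 ∨ c = 1) ∧ ((cubicPolynomial R).comp^[n] X).eval c = e := by
  induction n generalizing e with
  | zero => exact ⟨e, he, by simp⟩
  | succ n ih =>
    obtain ⟨c, hc, h⟩ := ih (e := 1 - e) (by rcases he with rfl | rfl <;> simp)
    refine ⟨c, hc, ?_⟩
    rw [Function.iterate_succ_apply', eval_comp, h, cubicPolynomial]
    rcases he with rfl | rfl <;> simp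
    norm_num

/-- The polynomial `f ^ n (z + c) - a`. -/
noncomputable def translatedIterate {R : Type*} [CommRing R] (n : ℕ) (c a : R) : R[X] :=
  ((cubicPolynomial R).comp^[n] X).comp (X + C c) - C a

theorem map_translatedIterate {R S : Type*} [CommRing R] [CommRing S] (φ : R →+* S)
    (n : ℕ) (c a : R) : (translatedIterate n c a).map φ = translatedIterate n (φ c) (φ a) := by
  simp [translatedIterate, Polynomial.map_comp, map_iterate_comp_cubicPolynomial]

theorem eval_zero_translatedIterate {R : Type*} [CommRing R] (n : ℕ) (c a : R) :
    (translatedIterate n c a).eval 0 = ((cubicPolynomial R).comp^[n] X).eval c - a := by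
  simp [translatedIterate, eval_comp]

open IsLocalRing in
-- Over the residue field, Frobenius additivity keeps the shape constant + u z^(3^n) under
-- translation, and the constant is the residue of e - a, which vanishes.
theorem isEisensteinAt_translatedIterate {A : Type*} [CommRing A] [IsDomain A] [IsLocalRing A]
    (h3 : (3 : A) ∈ maximalIdeal A) {n : ℕ} {c e a : A}
    (hc : ((cubicPolynomial A).comp^[n] X).eval c = e) (ha : e - a ∈ maximalIdeal A)
    (ha2 : e - a ∉ maximalIdeal A ^ 2) :
    (translatedIterate n c a).IsEisensteinAt (maximalIdeal A) ∧
      (translatedIterate n c a).natDegree = 3 ^ n := by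
  have h3k : ((3 : ℕ) : ResidueField A) = 0 := by
    rw [← map_natCast (residue A), residue_eq_zero_iff]
    exact_mod_cast h3
  have : CharP (ResidueField A) 3 := ringChar.of_eq
    (((Nat.dvd_prime Nat.prime_three).mp (ringChar.dvd h3k)).resolve_left CharP.ringChar_ne_one)
  obtain ⟨b, u, hu, h⟩ := iterate_comp_cubicPolynomial_of_charP (k := ResidueField A) n
  have : ExpChar (ResidueField A)[X] 3 := ExpChar.prime Nat.prime_three
  have hmap : (translatedIterate n c a).map (residue A) = C u * X ^ 3 ^ n := by
    have h1 : (translatedIterate n c a).map (residue A) =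
        C (b + u * residue A c ^ 3 ^ n - residue A a) + C u * X ^ 3 ^ n := by
      rw [map_translatedIterate, translatedIterate, h]
      simp only [add_comp, C_comp, mul_comp, pow_comp, X_comp, add_pow_expChar_pow]
      simp only [map_add, map_sub, map_mul, map_pow]
      ring
    have h2 := congrArg (eval 0) h1
    rw [map_translatedIterate, eval_zero_translatedIterate, ← map_iterate_comp_cubicPolynomial
      (residue A), eval_map_apply, hc, ← map_sub, (residue_eq_zero_iff _).mpr ha] at h2
    simp only [eval_add, eval_C, eval_mul, eval_pow, eval_X, ne_eq, pow_eq_zero_iff',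
      OfNat.ofNat_ne_zero, false_and, not_false_eq_true, zero_pow, mul_zero, add_zero] at h2
    rw [h1, ← h2, map_zero, zero_add]
  have hle : (translatedIterate n c a).natDegree ≤ 3 ^ n := by
    have hd : (cubicPolynomial A).natDegree ≤ 3 := by
      unfold cubicPolynomial; compute_degree
    rw [translatedIterate]
    refine (natDegree_sub_C).le.trans ?_
    rw [natDegree_comp, natDegree_iterate_comp, natDegree_X_add_C, natDegree_X, mul_one, mul_one]
    exact Nat.pow_le_pow_left hd n
  have hcoeff : ∀ i, residue A ((translatedIterate n c a).coeff i) =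
      if i = 3 ^ n then u else 0 := by
    intro i
    rw [← coeff_map, hmap, coeff_C_mul, coeff_X_pow]
    split_ifs <;> simp
  have htop : (translatedIterate n c a).coeff (3 ^ n) ∉ maximalIdeal A := by
    rw [← residue_eq_zero_iff, hcoeff, if_pos rfl]
    exact hu
  have hdeg : (translatedIterate n c a).natDegree = 3 ^ n := by
    refine le_antisymm hle (le_natDegree_of_ne_zero fun h0 => htop ?_)
    rw [h0]; exact zero_mem _
  refine ⟨⟨?_, fun {i} hi => ?_, ?_⟩, hdeg⟩
  · rwa [leadingCoeff, hdeg]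
  · rw [← residue_eq_zero_iff, hcoeff, if_neg (by omega)]
  · rwa [coeff_zero_eq_eval_zero, eval_zero_translatedIterate, hc]

theorem irreducible_map_of_isEisensteinAt {K : Type*} [Field K] (A : ValuationSubring K) {g : A[X]}
    (hg : g.IsEisensteinAt (IsLocalRing.maximalIdeal A)) (hd : 0 < g.natDegree) :
    Irreducible (g.map (algebraMap A K)) := by
  have hp : g.IsPrimitive := fun r hr => by
    have h1 : r ∣ g.leadingCoeff := (C_dvd_iff_dvd_coeff r g).mp hr _
    exact isUnit_of_dvd_unit h1 (by simpa using hg.leading)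
  exact hp.irreducible_iff_irreducible_map_fraction_map.mp
    (hg.irreducible (IsLocalRing.maximalIdeal.isMaximal A).isPrime hp hd)

theorem irreducible_comp_X_add_C_iff {K : Type*} [Field K] (p : K[X]) (c : K) :
    Irreducible (p.comp (X + C c)) ↔ Irreducible p := by
  rw [comp_eq_aeval, ← algEquivAevalXAddC_apply, MulEquiv.irreducible_iff]

end Eisenstein

/-! ### The Eisenstein property at a prime above 3. -/

section NumberField

variable {K : Type*} [Field K] [NumberField K]

theorem IsDedekindDomain.HeightOneSpectrum.valuation_natCast_lt_one {q : HeightOneSpectrum (𝓞 K)}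
    {l : ℕ} (hq : q.asIdeal.LiesOver (Ideal.span {(l : ℤ)})) : q.valuation K (l : K) < 1 := by
  have h1 : ((l : ℤ) : 𝓞 K) ∈ q.asIdeal := by
    have := (Ideal.mem_of_liesOver q.asIdeal (Ideal.span {(l : ℤ)}) (l : ℤ)).mp
      (Ideal.mem_span_singleton_self _)
    simpa using this
  have h2 := (q.valuation_lt_one_iff_mem (K := K) _).mpr h1
  simpa using h2

theorem valuation_le_mul_of_mem_sq {K Γ : Type*} [Field K] [LinearOrderedCommGroupWithZero Γ]
    (v : Valuation K Γ) {b : Γ} (hb : ∀ x : K, v x < 1 → v x ≤ b)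
    {x : v.valuationSubring} (hx : x ∈ IsLocalRing.maximalIdeal v.valuationSubring ^ 2) :
    v (x : K) ≤ b * b := by
  rw [sq] at hx
  refine Submodule.mul_induction_on hx (fun y hy z hz => ?_) fun y z hy hz => ?_
  · rw [Valuation.mem_maximalIdeal_iff] at hy hz
    rw [MulMemClass.coe_mul, map_mul]
    exact mul_le_mul' (hb _ hy) (hb _ hz)
  · exact (v.map_add _ _).trans (max_le hy hz)

theorem exists_isEisensteinAtPrime {q : HeightOneSpectrum (𝓞 K)}
    (hq : q.asIdeal.LiesOver (Ideal.span {(3 : ℤ)})) {α : K}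
    (hα : q.valuation K α = WithZero.exp (-1 : ℤ) ∨ q.valuation K (1 - α) = WithZero.exp (-1 : ℤ))
    (n : ℕ) : (∃ c : K, (c = 0 ∨ c = 1) ∧
      IsEisensteinAtPrime q ((iterateSub n α).comp (X + C c))) ∧ Irreducible (iterateSub n α) := by
  set v := q.valuation K with hv
  have hlt : WithZero.exp (-1 : ℤ) < 1 := by
    rw [← WithZero.exp_zero, WithZero.exp_lt_exp]; decide
  -- Discreteness: elements of the squared maximal ideal have value at most exp(-2), so value
  -- exp(-1) excludes them.
  have hle : ∀ x : K, v x < 1 → v x ≤ WithZero.exp (-1 : ℤ) := by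
    intro x hx
    rcases eq_or_ne (v x) 0 with h0 | h0
    · rw [h0]; exact zero_le
    · rw [← WithZero.exp_log h0, ← WithZero.exp_zero, WithZero.exp_lt_exp] at hx
      rw [← WithZero.exp_log h0, WithZero.exp_le_exp]
      omega
  obtain ⟨e, he, hev⟩ : ∃ e : v.valuationSubring, (e = 0 ∨ e = 1) ∧
      v ((e : K) - α) = WithZero.exp (-1 : ℤ) := by
    rcases hα with h | h
    · exact ⟨0, Or.inl rfl, by simpa using h⟩
    · exact ⟨1, Or.inr rfl, by simpa using h⟩
  have hαA : α ∈ v.valuationSubring := by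
    have h1 : (e : K) - α ∈ v.valuationSubring := by
      rw [Valuation.mem_valuationSubring_iff, hev]; exact hlt.le
    simpa using sub_mem e.2 h1
  obtain ⟨c, hc, hce⟩ := exists_iterate_eval_eq v.valuationSubring n he
  have h3 : (3 : v.valuationSubring) ∈ IsLocalRing.maximalIdeal v.valuationSubring := by
    rw [Valuation.mem_maximalIdeal_iff]
    exact_mod_cast HeightOneSpectrum.valuation_natCast_lt_one (l := 3) (by exact_mod_cast hq)
  have hE := isEisensteinAt_translatedIterate (a := ⟨α, hαA⟩) h3 hce
    (by rw [Valuation.mem_maximalIdeal_iff]; exact hev.trans_lt hlt)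
    (fun h => by
      have h1 := valuation_le_mul_of_mem_sq v hle h
      have h2 : v ((e - ⟨α, hαA⟩ : v.valuationSubring) : K) = WithZero.exp (-1 : ℤ) := hev
      rw [h2, ← WithZero.exp_add, WithZero.exp_le_exp] at h1
      exact absurd h1 (by decide))
  have hmap : (translatedIterate n c ⟨α, hαA⟩).map (algebraMap v.valuationSubring K) =
      (iterateSub n α).comp (X + C (c : K)) := by
    rw [map_translatedIterate, translatedIterate, iterateSub, sub_comp, C_comp]
    rfl
  refine ⟨⟨c, hc.imp (fun h => by rw [h]; rfl) (fun h => by rw [h]; rfl), _, hmap, hE.1⟩, ?_⟩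
  rw [← irreducible_comp_X_add_C_iff _ (c : K), ← hmap]
  exact irreducible_map_of_isEisensteinAt _ hE.1 (by rw [hE.2]; positivity)

end NumberField

/-! ### The Galois groups -/

/-- Chevalley's theorem: a valuation ring of Ω dominating that of v. Domination alone suffices
later, so value groups need not be compared. -/
theorem Valuation.exists_valuationSubring_extension {K Γ : Type*} [Field K]
    [LinearOrderedCommGroupWithZero Γ] (v : Valuation K Γ) (Ω : Type*) [Field Ω] [Algebra K Ω] :
    ∃ B : ValuationSubring Ω, ∀ x : K, v x < 1 → B.valuation (algebraMap K Ω x) < 1 := by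
  obtain ⟨B, hB, hloc⟩ := IsLocalRing.exists_factor_valuationRing
    ((algebraMap K Ω).comp (algebraMap v.valuationSubring K))
  refine ⟨B, fun x hx => ?_⟩
  have h1 : (⟨x, hx.le⟩ : v.valuationSubring) ∈ IsLocalRing.maximalIdeal v.valuationSubring := by
    rw [Valuation.mem_maximalIdeal_iff]; exact hx
  refine (B.valuation_lt_one_iff ⟨_, hB ⟨x, hx.le⟩⟩).mp ?_
  rw [IsLocalRing.mem_maximalIdeal, mem_nonunits_iff] at h1 ⊢
  exact fun hu => h1 (hloc.map_nonunit _ hu)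

section

variable {K : Type*} [Field K]

theorem aeval_iterateSub {Ω : Type*} [Field Ω] [Algebra K Ω] (n : ℕ) (α : K) (z : Ω) :
    aeval z (iterateSub n α) = cubicMap^[n] z - algebraMap K Ω α := by
  have h : (fun x : Ω => eval₂ (algebraMap K Ω) x (cubicPoly K)) = cubicMap := by
    funext x
    simp [cubicPoly, cubicMap]
  rw [iterateSub, map_sub, aeval_C, aeval_def, iterate_comp_eval₂, h, eval₂_X]

open IsTreeAction

theorem exists_smul_eq_of_irreducible {Ω : Type*} [Field Ω] [CharZero Ω] [IsAlgClosed Ω]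
    [Algebra K Ω] [Normal K Ω] {α : K} (h0 : algebraMap K Ω α ≠ 0) (h1 : algebraMap K Ω α ≠ 1)
    (hirr : ∀ n, Irreducible (iterateSub n α))
    [MulAction (Ω ≃ₐ[K] Ω) (List (Fin 3))] [IsTreeAction (Ω ≃ₐ[K] Ω)]
    (hnode : ∀ (g : Ω ≃ₐ[K] Ω) (v : List (Fin 3)),
        node (algebraMap K Ω α) (g • v) = g (node (algebraMap K Ω α) v))
    (u v : List (Fin 3)) (huv : u.length = v.length) : ∃ g : Ω ≃ₐ[K] Ω, g • u = v := by
  have hroot : ∀ w : List (Fin 3),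
      aeval (node (algebraMap K Ω α) w) (iterateSub w.length α) = 0 := fun w => by
    rw [aeval_iterateSub, iterate_cubicMap_node, sub_self]
  have hconj : IsConjRoot K (node (algebraMap K Ω α) v) (node (algebraMap K Ω α) u) := by
    rw [IsConjRoot, ← minpoly.eq_of_irreducible (hirr _) (hroot u),
      ← minpoly.eq_of_irreducible (hirr _) (hroot v), huv]
  obtain ⟨g, hg⟩ := isConjRoot_iff_exists_algEquiv.mp hconj
  exact ⟨g, eq_of_node_eq h0 h1 ((smul_length g u).trans huv) (by rw [hnode, hg])⟩

theorem ker_restrict_iterateSub {Ω : Type*} [Field Ω] [CharZero Ω] [IsAlgClosed Ω]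
    [Algebra K Ω] {α : K} (h0 : algebraMap K Ω α ≠ 0) (h1 : algebraMap K Ω α ≠ 1)
    [MulAction (Ω ≃ₐ[K] Ω) (List (Fin 3))] [IsTreeAction (Ω ≃ₐ[K] Ω)]
    (hnode : ∀ (g : Ω ≃ₐ[K] Ω) (v : List (Fin 3)),
        node (algebraMap K Ω α) (g • v) = g (node (algebraMap K Ω α) v))
    (n : ℕ) (hne : iterateSub n α ≠ 0)
    [Fact (((iterateSub n α).map (algebraMap K Ω)).Splits)] :
    (Gal.restrict (iterateSub n α) Ω).ker = levelKer (Ω ≃ₐ[K] Ω) n := by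
  ext g
  rw [MonoidHom.mem_ker]
  constructor
  · intro h v hv
    have hr : node (algebraMap K Ω α) v ∈ (iterateSub n α).rootSet Ω := by
      rw [mem_rootSet, aeval_iterateSub, ← hv, iterate_cubicMap_node, sub_self]
      exact ⟨by rwa [hv], rfl⟩
    have h2 := Gal.restrict_smul g (⟨_, hr⟩ : (iterateSub n α).rootSet Ω)
    rw [h, one_smul] at h2
    exact eq_of_node_eq h0 h1 (smul_length g v) (by rw [hnode, ← h2])
  · intro h
    refine Gal.galActionHom_injective (iterateSub n α) Ω ?_
    rw [map_one]
    ext ⟨x, hx⟩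
    rw [Gal.galActionHom, MulAction.toPermHom_apply, MulAction.toPerm_apply, Gal.restrict_smul]
    rw [mem_rootSet, aeval_iterateSub, sub_eq_zero] at hx
    obtain ⟨v, hv, rfl⟩ := exists_node_eq hx.2
    change g (node _ v) = node _ v
    rw [← hnode, h v hv]

theorem nonempty_gal_mulEquiv [NumberField K] {p : HeightOneSpectrum (𝓞 K)}
    (hp : p.asIdeal.LiesOver (Ideal.span {(2 : ℤ)})) {α : K}
    (hα : p.valuation K α = WithZero.exp (-1 : ℤ) ∨ p.valuation K (1 - α) = WithZero.exp (-1 : ℤ))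
    (hirr : ∀ n, Irreducible (iterateSub n α)) (n : ℕ) :
    Nonempty ((iterateSub n α).Gal ≃* treeE 3 2 n) := by
  set v := p.valuation K with hv
  have hlt : WithZero.exp (-1 : ℤ) < 1 := by
    rw [← WithZero.exp_zero, WithZero.exp_lt_exp]; decide
  have hαv : v (α * (1 - α)) = WithZero.exp (-1 : ℤ) := by
    rw [map_mul]
    rcases hα with h | h
    · rw [h, v.map_one_sub_of_lt (h.trans_lt hlt), mul_one]
    · rw [h, Valuation.map_eq_one_of_one_sub_lt (h.trans_lt hlt), one_mul]
  have hne : α * (1 - α) ≠ 0 := fun h => by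
    rw [h, map_zero] at hαv
    exact WithZero.exp_ne_zero hαv.symm
  let Ω := AlgebraicClosure K
  have h0 : algebraMap K Ω α ≠ 0 := by
    simpa using left_ne_zero_of_mul hne
  have h1 : algebraMap K Ω α ≠ 1 := fun h => right_ne_zero_of_mul hne (by
    rw [← map_one (algebraMap K Ω)] at h
    rw [(algebraMap K Ω).injective h, sub_self])
  obtain ⟨B, hB⟩ := v.exists_valuationSubring_extension Ω
  have h2 : B.valuation 2 < 1 := by
    rw [← map_ofNat (algebraMap K Ω) 2]
    refine hB _ ?_
    exact_mod_cast HeightOneSpectrum.valuation_natCast_lt_one (l := 2) (by exact_mod_cast hp)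
  have hαw : B.valuation (algebraMap K Ω α) < 1 ∨ B.valuation (1 - algebraMap K Ω α) < 1 :=
    hα.imp (fun h => hB _ (h.trans_lt hlt)) (fun h => by
      rw [← map_one (algebraMap K Ω), ← map_sub]; exact hB _ (h.trans_lt hlt))
  have hsq : ∀ c : K, B.valuation (algebraMap K Ω c) ^ 2 ≠
      B.valuation (algebraMap K Ω α * (1 - algebraMap K Ω α)) := by
    intro c hc
    rw [← map_one (algebraMap K Ω), ← map_sub, ← map_mul, ← map_pow, ← map_pow] at hc
    have hd0 : B.valuation (algebraMap K Ω (α * (1 - α))) ≠ 0 :=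
      B.valuation.ne_zero_iff.mpr ((_root_.map_ne_zero _).mpr hne)
    have hc0 : c ^ 2 ≠ 0 := fun h => by
      rw [h, map_zero, map_zero] at hc
      exact hd0 hc.symm
    -- Domination lets equal values over Ω be pulled back to K; applied both ways, it gives v(c)^2 =
    -- exp(-1), impossible by parity.
    have hr : ∀ x y : K, y ≠ 0 →
        B.valuation (algebraMap K Ω x) = B.valuation (algebraMap K Ω y) → v y ≤ v x := by
      intro x y hy hxy
      by_contra! hlt
      have h3 := hB (x / y) (by
        rw [map_div₀, div_lt_one₀ (zero_lt_iff.mpr (v.ne_zero_iff.mpr hy))]; exact hlt)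
      rw [map_div₀, map_div₀, hxy, div_self (by simpa using hy)] at h3
      exact lt_irrefl _ h3
    have heq : v (c ^ 2) = WithZero.exp (-1 : ℤ) := by
      rw [← hαv]
      exact le_antisymm (hr _ _ hc0 hc.symm) (hr _ _ hne hc)
    rw [map_pow, ← WithZero.exp_log (v.ne_zero_iff.mpr (fun h => hc0 (by rw [h]; simp))),
      ← WithZero.exp_nsmul, WithZero.exp_inj, nsmul_eq_mul] at heq
    push_cast at heq
    omega
  obtain ⟨_, _, hnode⟩ := exists_treeAction (Ω := Ω) h0 h1
  have hS := prod_sgn_galois hnode h0 h1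
  have hT := exists_smul_eq_of_irreducible h0 h1 hirr hnode
  obtain ⟨path, hpath, hw⟩ := exists_ramified_path B.valuation h2 hαw
  have hP := exists_sgn_neg_of_ramified_path B.valuation h2 h0 h1 hnode hpath hw hsq
  have hF := full_of_path hpath hS hT hP
  have : Fact (((iterateSub n α).map (algebraMap K Ω)).Splits) := ⟨IsAlgClosed.splits _⟩
  have hker : (Gal.restrict (iterateSub n α) Ω).ker = (toTreeAut (Ω ≃ₐ[K] Ω) n).ker := by
    rw [ker_toTreeAut, ker_restrict_iterateSub h0 h1 hnode n (hirr n).ne_zero]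
  exact ⟨(QuotientGroup.quotientKerEquivOfSurjective (Gal.restrict (iterateSub n α) Ω)
    (Gal.restrict_surjective _ _)).symm.trans <|
    (QuotientGroup.quotientMulEquivOfEq hker).trans <|
    (QuotientGroup.quotientKerEquivRange (toTreeAut (Ω ≃ₐ[K] Ω) n)).trans <|
    MulEquiv.subgroupCongr (range_toTreeAut hS hF n)⟩

end

theorem theorem3 {K : Type*} [Field K] [NumberField K]
    (p q : HeightOneSpectrum (𝓞 K))
    (hp : p.asIdeal.LiesOver (Ideal.span {(2 : ℤ)}))
    (hq : q.asIdeal.LiesOver (Ideal.span {(3 : ℤ)}))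
    (α : K)
    (hqα : q.valuation K α = WithZero.exp (-1 : ℤ) ∨ q.valuation K (1 - α) = WithZero.exp (-1 : ℤ))
    (hpα : p.valuation K α = WithZero.exp (-1 : ℤ) ∨ p.valuation K (1 - α) = WithZero.exp (-1 : ℤ))
    (n : ℕ) (hn : 1 ≤ n) :
    (∃ c : K, (c = 0 ∨ c = 1) ∧ IsEisensteinAtPrime q ((iterateSub n α).comp (X + C c))) ∧
      Irreducible (iterateSub n α) ∧
      Nonempty ((iterateSub n α).Gal ≃* treeE 3 2 n) :=
  ⟨(exists_isEisensteinAtPrime hq hqα n).1, (exists_isEisensteinAtPrime hq hqα n).2,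
    nonempty_gal_mulEquiv hp hpα (fun m => (exists_isEisensteinAtPrime hq hqα m).2) n⟩
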